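/- Let $\mathbb H$ be the quaternions and $\mathbb S=\{I\in\mathbb H: I^2=-1\}$. A function $f:\mathbb H\to\mathbb H$ is slice regular if it is real differentiable and, for every $I\in\mathbb S$, the function $(x,y)\mapsto f(x+Iy)$ is $C^1$ on $\mathbb R^2$ and satisfies $\frac12\left(\partial_x+I\,\partial_y\right)f(x+Iy)=0$. For $J\in\mathbb S$ let $\mathcal F^2_{slice}(\mathbb H)$ be the space of all slice regular $f$ with $$\int_{\mathbb R^2}|f(x+Jy)|^2e^{-(x^2+y^2)}\,dx\,dy<\infty .$$ For $\psi\in L^2(\mathbb R;\mathbb H)$ let $$\mathcal B\psi(q)=\pi^{-3/4}\int_{\mathbb R}e^{-\frac12(q^2+x^2)+\sqrt2\,qx}\,\psi(x)\,dx\qquad(q\in\mathbb H),$$ and for $I\in\mathbb S$ and $\psi\in L^1(\mathbb R;\mathbb H)$ let $\mathcal F_I\psi(x)=\int_{\mathbb R}e^{Ixy}\psi(y)\,dy$. Theorem. Let $I,J\in\mathbb S$ be arbitrary. Then $\mathcal B$ is a bijection of $L^2(\mathbb R;\mathbb H)$ onto $\mathcal F^2_{slice}(\mathbb H)$ (defined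 through the slice of $J$; in particular the space does not depend on $J$), so that $\mathcal B^{-1}:\mathcal F^2_{slice}(\mathbb H)\to L^2(\mathbb R;\mathbb H)$ is defined; the restriction of $\mathcal F_I$ to $L^1\cap L^2$ has a unique extension to a bounded real-linear operator on $L^2(\mathbb R;\mathbb H)$, again denoted $\mathcal F_I$; and for every $f\in\mathcal F^2_{slice}(\mathbb H)$ and every $x\in\mathbb R$, $$\mathcal B\,\mathcal F_I\,\mathcal B^{-1}(f)(x)=\sqrt{2\pi}\,f(Ix).$$ -/

import Mathlib

open MeasureTheory
open scoped Quaternion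

noncomputable section

namespace SliceFock

/-- The sphere `𝕊` of imaginary units of the quaternions. -/
def imagUnits : Set ℍ[ℝ] := {I | I ^ 2 = -1}

/-- The point `x + y I` of the slice `ℂ_I = ℝ + ℝ I`. -/
def slicePt (I : ℍ[ℝ]) (x y : ℝ) : ℍ[ℝ] := (x : ℍ[ℝ]) + (y : ℍ[ℝ]) * I

/-- (Left) slice regular functions on the whole of `ℍ`: real differentiable, and for every
imaginary unit `I` the restriction to the slice `ℂ_I` is of class `C¹` in `(x, y)` and is
annihilated by `(1/2) (∂/∂x + I ∂/∂y)`. -/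
structure IsSliceRegular (f : ℍ[ℝ] → ℍ[ℝ]) : Prop where
  differentiable : Differentiable ℝ f
  contDiff_slice : ∀ I ∈ imagUnits, ContDiff ℝ 1 (fun p : ℝ × ℝ => f (slicePt I p.1 p.2))
  dbar_eq_zero : ∀ I ∈ imagUnits, ∀ x y : ℝ,
    (1 / 2 : ℝ) • (deriv (fun s : ℝ => f (slicePt I s y)) x
      + I * deriv (fun t : ℝ => f (slicePt I x t)) y) = 0

/-- The slice hyperholomorphic Bargmann-Fock space `F^{2,ν}_J(ℍ)`: slice regular functions on `ℍ`
whose restriction to the slice `ℂ_J` is square integrable for `e^{-ν |q|²} dx dy`. -/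
def fockSpace (ν : ℝ) (J : ℍ[ℝ]) : Set (ℍ[ℝ] → ℍ[ℝ]) :=
  {f | IsSliceRegular f ∧
    Integrable (fun p : ℝ × ℝ =>
      ‖f (slicePt J p.1 p.2)‖ ^ 2 * Real.exp (-ν * ‖slicePt J p.1 p.2‖ ^ 2)) volume}

/-- The Hilbert space `L²(ℝ; ℍ)`, with Lebesgue measure on `ℝ`. -/
abbrev L2 : Type := Lp ℍ[ℝ] 2 (volume : Measure ℝ)

/-- The kernel `A(q; x) = (ν/π)^{3/4} exp(-(ν/2) (q² + x²) + ν √2 q x)`. -/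
def kernelA (ν : ℝ) (q : ℍ[ℝ]) (x : ℝ) : ℍ[ℝ] :=
  ((ν / Real.pi) ^ (3 / 4 : ℝ) : ℝ) •
    NormedSpace.exp ((-ν / 2 : ℝ) • (q ^ 2 + (x : ℍ[ℝ]) ^ 2)
      + (ν * Real.sqrt 2) • (q * (x : ℍ[ℝ])))

/-- The quaternionic Segal-Bargmann transform `B_ν`, on `L²(ℝ; ℍ)`. -/
def segalBargmann (ν : ℝ) (ψ : L2) (q : ℍ[ℝ]) : ℍ[ℝ] :=
  ∫ x : ℝ, kernelA ν q x * ψ x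

/-- The inverse of `B_ν` (meaningful on the range of `B_ν`, where `B_ν` is injective). -/
def segalBargmannInv (ν : ℝ) : (ℍ[ℝ] → ℍ[ℝ]) → L2 :=
  Function.invFun (segalBargmann ν)

/-- The left one-dimensional quaternionic Fourier integral `∫ e^{I x y} ψ(y) dy`
of an integrable function. -/
def fourierIntegral (I : ℍ[ℝ]) (ψ : ℝ → ℍ[ℝ]) (x : ℝ) : ℍ[ℝ] :=
  ∫ y : ℝ, NormedSpace.exp (I * (x : ℍ[ℝ]) * (y : ℍ[ℝ])) * ψ y

/-- `T` is a bounded (real linear) operator of `L²(ℝ; ℍ)` that is given on `L¹ ∩ L²` by the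
Fourier integral. -/
def IsFourierExtension (I : ℍ[ℝ]) (T : L2 →L[ℝ] L2) : Prop :=
  ∀ ψ : L2, Integrable (ψ : ℝ → ℍ[ℝ]) volume →
    (T ψ : ℝ → ℍ[ℝ]) =ᵐ[volume] fourierIntegral I (ψ : ℝ → ℍ[ℝ])

open Classical in
/-- The Fourier transform `F_I` on `L²(ℝ; ℍ)`: the bounded extension of the Fourier integral
from the dense subspace `L¹ ∩ L²`. -/
def fourierL2 (I : ℍ[ℝ]) : L2 →L[ℝ] L2 :=
  if h : ∃ T : L2 →L[ℝ] L2, IsFourierExtension I T then h.choose else 0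

end SliceFock

end

/-! Left multiplication by an imaginary unit `I` makes `ℍ` a complex Hilbert space, `SliceMod I`.
The kernels of the Segal-Bargmann and Fourier integrals are power series with real coefficients in
elements of one slice. So on the slice of `I` both operators become their classical complex
counterparts for Hilbert-space-valued functions (`toSlice_sb_embed`, `toSlice_fourierIntegral`).

Three classical facts are needed. The weighted transform is an isometry (`lintegral_enorm_wB`): on a
vertical line the Bargmann transform is a Fourier transform, so Plancherel in `y` leaves a Gaussian
integral in `x`. It reaches every entire function in the Fock space (`exists_cB_eq`): the adjoint
produces the preimage, which is tested against coherent states through the reproducing formula. It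
turns the Fourier transform into rotation by `i` (`cB_fourierCL2`): the Fourier transform of the
kernel at real `x` is the kernel at `ix`, and density of `L¹ ∩ L²` does the rest.

The slices are glued by the identity theorem (`IsSliceRegular.ext_real`): every quaternion lies on a
slice, every slice contains the real line, and a slice regular function is holomorphic on each
slice. Surjectivity can therefore be checked on the slice of `J` alone. The intertwining formula
involves only `x` and `Ix`, both on the slice of `I`, so `I` and `J` never interact. -/

noncomputable section

namespace SliceFock

/-! ### Plancherel and the Fourier integral for Hilbert-space-valued functions -/

section Fourier

open FourierTransform
open scoped ContDiff

variable {E : Type*} [NormedAddCommGroup E] [InnerProductSpace ℂ E]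

/-- Fubini for a symmetric kernel. Negating the pairing presents the inverse transform as a forward
one, to which the general flip formula applies. -/
theorem integral_fourierInv_smul_eq [CompleteSpace E] {f : ℝ → ℂ} {g : ℝ → E} (hf : Integrable f)
    (hg : Integrable g) : ∫ ξ, 𝓕⁻ f ξ • g ξ = ∫ x, f x • 𝓕⁻ g x := by
  have key := VectorFourier.integral_fourierIntegral_smul_eq_flip (L := -innerₗ ℝ)
    (e := Real.fourierChar) (μ := volume) (ν := volume)
    Real.continuous_fourierChar (by exact (continuous_inner (𝕜 := ℝ) (E := ℝ)).neg) hf hg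
  have h1 : ∀ ξ, 𝓕⁻ f ξ =
      VectorFourier.fourierIntegral Real.fourierChar volume (-innerₗ ℝ) f ξ := by
    intro ξ
    rw [Real.fourierInv_eq]
    simp [VectorFourier.fourierIntegral]
  have h2 : ∀ x, 𝓕⁻ g x =
      VectorFourier.fourierIntegral Real.fourierChar volume (-innerₗ ℝ).flip g x := by
    intro x
    rw [Real.fourierInv_eq]
    simp [VectorFourier.fourierIntegral, mul_comm]
  simp_rw [h1, h2]
  exact key

/-- On `L¹ ∩ L²` the inverse Fourier transform of `L²` is given by the Fourier integral. -/
theorem coeFn_fourierInv_ae_eq [CompleteSpace E] (f : Lp E 2 (volume : Measure ℝ))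
    (hf : Integrable (f : ℝ → E)) :
    ((𝓕⁻ f : Lp E 2 (volume : Measure ℝ)) : ℝ → E) =ᵐ[volume] 𝓕⁻ (f : ℝ → E) := by
  have hcont : Continuous (𝓕⁻ (f : ℝ → E)) := by
    have : 𝓕⁻ (f : ℝ → E) = fun x => 𝓕 (f : ℝ → E) (-x) := by
      ext x; exact Real.fourierInv_eq_fourier_neg _ _
    rw [this]
    exact (VectorFourier.fourierIntegral_continuous Real.continuous_fourierChar
      (by exact continuous_inner) hf).comp continuous_neg
  -- Both sides are tested against smooth compactly supported `g`. The transform moves onto `g` by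
  -- the distributional definition on the `L²` side and by the multiplication formula on the `L¹`
  -- side.
  refine ae_eq_of_integral_contDiff_smul_eq
    ((Lp.memLp _).locallyIntegrable (by norm_num)) hcont.locallyIntegrable ?_
  intro g g_smooth g_cpt
  have hg₁ : HasCompactSupport (Complex.ofRealCLM ∘ g) := g_cpt.comp_left rfl
  have hg₂ : ContDiff ℝ ∞ (Complex.ofRealCLM ∘ g) := by fun_prop
  set G := hg₁.toSchwartzMap hg₂ with hG
  have h1 := congrArg (fun T => T G) (Lp.fourierInv_toTemperedDistribution_eq f)
  simp only [TemperedDistribution.fourierInv_apply, Lp.toTemperedDistribution_apply] at h1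
  have hGc : ∀ x, G x = (g x : ℂ) := fun x => rfl
  calc ∫ x, g x • (𝓕⁻ f : Lp E 2 (volume : Measure ℝ)) x
      = ∫ x, G x • (𝓕⁻ f : Lp E 2 (volume : Measure ℝ)) x := by simp [hGc]
    _ = ∫ x, (𝓕⁻ G) x • f x := h1.symm
    _ = ∫ x, 𝓕⁻ (G : ℝ → ℂ) x • f x := by rw [SchwartzMap.fourierInv_coe]
    _ = ∫ x, G x • 𝓕⁻ (f : ℝ → E) x := integral_fourierInv_smul_eq G.integrable hf
    _ = ∫ x, g x • 𝓕⁻ (f : ℝ → E) x := by simp [hGc]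

/-- Plancherel's theorem on `L¹ ∩ L²`. -/
theorem eLpNorm_fourierInv_eq [CompleteSpace E] {f : ℝ → E} (hf : Integrable f) (hf2 : MemLp f 2) :
    eLpNorm (𝓕⁻ f) 2 volume = eLpNorm f 2 volume := by
  have h := coeFn_fourierInv_ae_eq (hf2.toLp f) (hf.congr hf2.coeFn_toLp.symm)
  have h' : 𝓕⁻ ((hf2.toLp f : Lp E 2 (volume : Measure ℝ)) : ℝ → E) = 𝓕⁻ f := by
    ext x
    rw [Real.fourierInv_eq, Real.fourierInv_eq]
    refine integral_congr_ae ?_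
    filter_upwards [hf2.coeFn_toLp] with y hy
    rw [hy]
  rw [h'] at h
  rw [← eLpNorm_congr_ae h, ← eLpNorm_congr_ae hf2.coeFn_toLp, ← ENNReal.toReal_eq_toReal_iff'
    (Lp.eLpNorm_ne_top _) (Lp.eLpNorm_ne_top _), ← Lp.norm_def, ← Lp.norm_def]
  exact (Lp.fourierTransformₗᵢ ℝ E).symm.norm_map _

/-- The Fourier integral `∫ e^{i x y} ψ(y) dy`. -/
def fourierC (ψ : ℝ → E) (x : ℝ) : E := ∫ y : ℝ, Complex.exp (Complex.I * x * y) • ψ y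

/-- `𝓕⁻` has kernel `e^{2πixy}`, hence the dilation by `(2π)⁻¹`. -/
theorem fourierC_eq_fourierInv (ψ : ℝ → E) (x : ℝ) :
    fourierC ψ x = 𝓕⁻ ψ ((2 * Real.pi)⁻¹ * x) := by
  rw [Real.fourierInv_eq, fourierC]
  refine integral_congr_ae (.of_forall fun y => ?_)
  simp only [Circle.smul_def, Real.fourierChar_apply]
  congr 2
  have : (Real.pi : ℂ) ≠ 0 := by exact_mod_cast Real.pi_ne_zero
  simp
  field_simp

theorem eLpNorm_two_sq {α F : Type*} [MeasurableSpace α] [NormedAddCommGroup F] {μ : Measure α}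
    (g : α → F) : eLpNorm g 2 μ ^ 2 = ∫⁻ x, ‖g x‖ₑ ^ 2 ∂μ := by
  simpa using eLpNorm_nnreal_pow_eq_lintegral (f := g) (μ := μ) (p := 2) (by norm_num)

theorem eLpNorm_comp_mul_left {F : Type*} [NormedAddCommGroup F] {c : ℝ} (hc : c ≠ 0) (f : ℝ → F) :
    eLpNorm (fun x => f (c * x)) 2 volume =
      ENNReal.ofReal |c⁻¹| ^ (1 / (2 : ℝ)) * eLpNorm f 2 volume := by
  have h := (Homeomorph.mulLeft₀ c hc).measurableEmbedding.eLpNorm_map_measure (μ := volume)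
    (g := f) (p := 2)
  have h2 : Measure.map (⇑(Homeomorph.mulLeft₀ c hc)) volume
      = ENNReal.ofReal |c⁻¹| • (volume : Measure ℝ) := Real.map_volume_mul_left hc
  rw [h2, eLpNorm_smul_measure_of_ne_top (by norm_num)] at h
  rw [show (fun x => f (c * x)) = f ∘ ⇑(Homeomorph.mulLeft₀ c hc) from rfl, ← h]
  simp

theorem lintegral_comp_mul_left {F : Type*} [NormedAddCommGroup F] {c : ℝ} (hc : c ≠ 0)
    (f : ℝ → F) :
    ∫⁻ x, ‖f (c * x)‖ₑ ^ 2 = ENNReal.ofReal |c⁻¹| * ∫⁻ x, ‖f x‖ₑ ^ 2 := by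
  rw [← eLpNorm_two_sq, ← eLpNorm_two_sq, eLpNorm_comp_mul_left hc, mul_pow]
  congr 1
  rw [← ENNReal.rpow_natCast, ← ENNReal.rpow_mul]
  simp

theorem quasiMeasurePreserving_mul_left {c : ℝ} (hc : c ≠ 0) :
    Measure.QuasiMeasurePreserving (fun x : ℝ => c * x) volume volume := by
  refine ⟨by fun_prop, ?_⟩
  rw [Real.map_volume_mul_left hc]
  exact Measure.smul_absolutelyContinuous

theorem memLp_comp_mul_left {F : Type*} [NormedAddCommGroup F] {c : ℝ} (hc : c ≠ 0)
    {f : ℝ → F} (hf : MemLp f 2) :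
    MemLp (fun x => f (c * x)) 2 := by
  refine ⟨hf.1.comp_quasiMeasurePreserving (quasiMeasurePreserving_mul_left hc), ?_⟩
  rw [eLpNorm_comp_mul_left hc]
  exact ENNReal.mul_lt_top (ENNReal.rpow_lt_top_of_nonneg (by norm_num) ENNReal.ofReal_ne_top) hf.2

/-- Dilation `f ↦ f (c ·)` on `L²(ℝ; E)`. -/
def dilation (c : ℝ) (hc : c ≠ 0) :
    Lp E 2 (volume : Measure ℝ) →L[ℂ] Lp E 2 (volume : Measure ℝ) :=
  LinearMap.mkContinuous
    { toFun := fun f => (memLp_comp_mul_left hc (Lp.memLp f)).toLp _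
      map_add' := fun f g => by
        rw [← MemLp.toLp_add]
        exact MemLp.toLp_congr _ _
          ((quasiMeasurePreserving_mul_left hc).ae_eq_comp (Lp.coeFn_add f g))
      map_smul' := fun a f => by
        rw [RingHom.id_apply, ← MemLp.toLp_const_smul]
        exact MemLp.toLp_congr _ _
          ((quasiMeasurePreserving_mul_left hc).ae_eq_comp (Lp.coeFn_smul a f)) }
    (ENNReal.ofReal |c⁻¹| ^ (1 / (2 : ℝ))).toReal
    (fun f => by
      simp only [LinearMap.coe_mk, AddHom.coe_mk]
      rw [Lp.norm_toLp, eLpNorm_comp_mul_left hc, ENNReal.toReal_mul, Lp.norm_def])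

theorem coeFn_dilation {c : ℝ} (hc : c ≠ 0) (f : Lp E 2 (volume : Measure ℝ)) :
    (dilation c hc f : ℝ → E) =ᵐ[volume] fun x => f (c * x) :=
  MemLp.coeFn_toLp (memLp_comp_mul_left hc (Lp.memLp f))

theorem inv_two_pi_ne_zero : (2 * Real.pi)⁻¹ ≠ 0 := by positivity

variable (E) in
/-- The Fourier transform `∫ e^{i x y} ψ(y) dy`, extended to `L²(ℝ; E)`. -/
def fourierCL2 [CompleteSpace E] : Lp E 2 (volume : Measure ℝ) →L[ℂ] Lp E 2 (volume : Measure ℝ) :=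
  (dilation (2 * Real.pi)⁻¹ inv_two_pi_ne_zero).comp
    ((Lp.fourierTransformₗᵢ ℝ E).symm.toContinuousLinearEquiv : _ →L[ℂ] _)

theorem coeFn_fourierCL2 [CompleteSpace E] (ψ : Lp E 2 (volume : Measure ℝ))
    (hψ : Integrable (ψ : ℝ → E)) :
    (fourierCL2 E ψ : ℝ → E) =ᵐ[volume] fourierC ψ := by
  refine (coeFn_dilation inv_two_pi_ne_zero _).trans ?_
  have h := (quasiMeasurePreserving_mul_left inv_two_pi_ne_zero).ae_eq_comp
    (coeFn_fourierInv_ae_eq ψ hψ)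
  filter_upwards [h] with x hx
  rw [fourierC_eq_fourierInv]
  exact hx

/-- Plancherel's theorem for `fourierC`. -/
theorem lintegral_enorm_fourierC [CompleteSpace E] {f : ℝ → E} (hf : Integrable f)
    (hf2 : MemLp f 2) :
    ∫⁻ x, ‖fourierC f x‖ₑ ^ 2 = ENNReal.ofReal (2 * Real.pi) * ∫⁻ x, ‖f x‖ₑ ^ 2 := by
  have h1 : fourierC f = fun x => 𝓕⁻ f ((2 * Real.pi)⁻¹ * x) :=
    funext (fourierC_eq_fourierInv f)
  rw [h1, lintegral_comp_mul_left inv_two_pi_ne_zero (𝓕⁻ f), ← eLpNorm_two_sq,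
    eLpNorm_fourierInv_eq hf hf2, eLpNorm_two_sq, inv_inv, abs_of_pos Real.two_pi_pos]

end Fourier

/-! ### Differentiability of Laplace transforms over a possibly noncommutative algebra -/

section Exp

variable {𝕜 𝔸 : Type*} [RCLike 𝕜] [NormedRing 𝔸] [NormedAlgebra 𝕜 𝔸]
  [CompleteSpace 𝔸]

theorem norm_pow_succ_sub_pow_succ_le {R : Type*} [NormedRing R] [NormOneClass R] {a b : R}
    {r : ℝ} (ha : ‖a‖ ≤ r) (hb : ‖b‖ ≤ r) (n : ℕ) :
    ‖a ^ (n + 1) - b ^ (n + 1)‖ ≤ (n + 1) * r ^ n * ‖a - b‖ := by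
  have hr : 0 ≤ r := (norm_nonneg a).trans ha
  induction n with
  | zero => simp
  | succ n ih =>
    have h : a ^ (n + 1 + 1) - b ^ (n + 1 + 1)
        = a ^ (n + 1) * (a - b) + (a ^ (n + 1) - b ^ (n + 1)) * b := by
      rw [pow_succ a (n + 1), pow_succ b (n + 1)]; noncomm_ring
    rw [h]
    calc _ ≤ ‖a ^ (n + 1)‖ * ‖a - b‖ + ‖a ^ (n + 1) - b ^ (n + 1)‖ * ‖b‖ :=
          (norm_add_le _ _).trans (add_le_add (norm_mul_le _ _) (norm_mul_le _ _))
      _ ≤ r ^ (n + 1) * ‖a - b‖ + ((n + 1) * r ^ n * ‖a - b‖) * r := by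
          gcongr
          exact (norm_pow_le _ _).trans (by gcongr)
      _ = _ := by push_cast; ring

/-- Termwise telescoping of the series: the constant terms cancel and `(n+1)/(n+1)! = 1/n!`. This
explicit Lipschitz constant replaces a formula for the derivative of `exp`, which is not simply
`exp` when the algebra is noncommutative. -/
theorem norm_exp_sub_exp_le (𝕜 : Type*) {𝔸 : Type*} [RCLike 𝕜] [NormedRing 𝔸]
    [NormOneClass 𝔸] [NormedAlgebra 𝕜 𝔸] [CompleteSpace 𝔸] {a b : 𝔸} {r : ℝ}
    (ha : ‖a‖ ≤ r) (hb : ‖b‖ ≤ r) :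
    ‖NormedSpace.exp a - NormedSpace.exp b‖ ≤ Real.exp r * ‖a - b‖ := by
  have hs := (NormedSpace.exp_series_hasSum_exp' (𝕂 := 𝕜) a).sub
    (NormedSpace.exp_series_hasSum_exp' (𝕂 := 𝕜) b)
  have hs' := (hasSum_nat_add_iff' 1).2 hs
  simp only [Finset.range_one, Finset.sum_singleton, pow_zero, sub_self, sub_zero] at hs'
  have hR : HasSum (fun n : ℕ => (r ^ n / n.factorial) * ‖a - b‖) (Real.exp r * ‖a - b‖) := by
    rw [Real.exp_eq_exp_ℝ]
    exact (NormedSpace.expSeries_div_hasSum_exp r).mul_right _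
  rw [← hs'.tsum_eq]
  refine tsum_of_norm_bounded hR fun n => ?_
  rw [← smul_sub, norm_smul, norm_inv, RCLike.norm_natCast, Nat.factorial_succ]
  have hf : (0 : ℝ) < n.factorial := by positivity
  calc _ ≤ (((n + 1) * n.factorial : ℕ) : ℝ)⁻¹ * ((n + 1) * r ^ n * ‖a - b‖) := by
        gcongr
        exact norm_pow_succ_sub_pow_succ_le ha hb n
    _ = _ := by push_cast; field_simp

theorem contDiff_exp {𝕜 𝔸 : Type*} [RCLike 𝕜] [NormedRing 𝔸] [NormedAlgebra 𝕜 𝔸]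
    [CompleteSpace 𝔸] : ContDiff 𝕜 1 (NormedSpace.exp : 𝔸 → 𝔸) :=
  contDiff_iff_contDiffAt.2 fun x => (NormedSpace.exp_analytic (𝕂 := 𝕜) x).contDiffAt

theorem aestronglyMeasurable_exp_smul_apply {E : Type*} [NormedAddCommGroup E] [NormedSpace 𝕜 E]
    (L : 𝔸 →L[𝕜] E →L[𝕜] E) {φ : ℝ → E} (hm : AEStronglyMeasurable φ) (q : 𝔸) :
    AEStronglyMeasurable fun t : ℝ => L (NormedSpace.exp ((t : 𝕜) • q)) (φ t) := by
  have hcont : Continuous fun t : ℝ => NormedSpace.exp ((t : 𝕜) • q) :=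
    (contDiff_exp (𝕜 := 𝕜)).continuous.comp (by fun_prop)
  exact L.aestronglyMeasurable_comp₂ hcont.aestronglyMeasurable hm

theorem integrable_exp_smul_apply [NormOneClass 𝔸] {E : Type*} [NormedAddCommGroup E]
    [NormedSpace 𝕜 E] (L : 𝔸 →L[𝕜] E →L[𝕜] E) {φ : ℝ → E} (hm : AEStronglyMeasurable φ)
    (hφ : ∀ c : ℝ, Integrable fun t => Real.exp (c * |t|) * ‖φ t‖) (q : 𝔸) :
    Integrable fun t : ℝ => L (NormedSpace.exp ((t : 𝕜) • q)) (φ t) := by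
  have hexp1 : ∀ t : ℝ,
      ‖NormedSpace.exp ((t : 𝕜) • q)‖ ≤ 1 + Real.exp (‖q‖ * |t|) * (‖q‖ * |t|) := by
    intro t
    have h1 : ‖(t : 𝕜) • q‖ = ‖q‖ * |t| := by
      rw [norm_smul, RCLike.norm_ofReal, mul_comm]
    have := norm_exp_sub_exp_le 𝕜 (a := (t : 𝕜) • q) (b := 0) (r := ‖q‖ * |t|) h1.le
      (by simpa using by positivity)
    rw [NormedSpace.exp_zero, sub_zero, h1] at this
    calc _ = ‖1 + (NormedSpace.exp ((t : 𝕜) • q) - 1)‖ := by rw [add_sub_cancel]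
      _ ≤ _ := (norm_add_le _ _).trans (by rw [norm_one]; gcongr)
  refine (((hφ 0).add (hφ (‖q‖ + ‖q‖))).const_mul ‖L‖).mono'
    (aestronglyMeasurable_exp_smul_apply L hm q) (.of_forall fun t => ?_)
  have h2 : ‖q‖ * |t| ≤ Real.exp (‖q‖ * |t|) :=
    (by linarith : ‖q‖ * |t| ≤ ‖q‖ * |t| + 1).trans (Real.add_one_le_exp _)
  calc _ ≤ ‖L‖ * ‖NormedSpace.exp ((t : 𝕜) • q)‖ * ‖φ t‖ := L.le_opNorm₂ _ _
    _ ≤ ‖L‖ * (1 + Real.exp (‖q‖ * |t|) * Real.exp (‖q‖ * |t|)) * ‖φ t‖ := by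
        gcongr
        exact (hexp1 t).trans (by gcongr)
    _ = _ := by rw [← Real.exp_add]; simp; ring_nf

/-- A two-sided Laplace transform of a function with super-exponential decay is differentiable. -/
theorem differentiable_integral_exp_smul [NormOneClass 𝔸] {E : Type*} [NormedAddCommGroup E]
    [NormedSpace ℝ E] [NormedSpace 𝕜 E] (L : 𝔸 →L[𝕜] E →L[𝕜] E) {φ : ℝ → E}
    (hm : AEStronglyMeasurable φ) (hφ : ∀ c : ℝ, Integrable fun t => Real.exp (c * |t|) * ‖φ t‖) :
    Differentiable 𝕜 fun q : 𝔸 => ∫ t : ℝ, L (NormedSpace.exp ((t : 𝕜) • q)) (φ t) := by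
  intro q₀
  have hexp : ContDiff 𝕜 1 (NormedSpace.exp : 𝔸 → 𝔸) := contDiff_exp
  -- In `‖q₀‖ + 2`, one unit comes from the radius of the ball and the other absorbs the factor `|t|
  -- ≤ e^{|t|}` of the Lipschitz bound.
  refine (hasFDerivAt_integral_of_dominated_loc_of_lip' (𝕜 := 𝕜)
    (bound := fun t => ‖L‖ * (Real.exp ((‖q₀‖ + 2) * |t|) * ‖φ t‖))
    (F' := fun t : ℝ => (L.flip (φ t)).comp
      ((t : 𝕜) • fderiv 𝕜 (NormedSpace.exp : 𝔸 → 𝔸) ((t : 𝕜) • q₀)))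
    (Metric.ball_mem_nhds q₀ one_pos) (fun q _ => aestronglyMeasurable_exp_smul_apply L hm q)
    (integrable_exp_smul_apply L hm hφ q₀) ?_ ?_ ((hφ _).const_mul _) ?_).2.differentiableAt
  · refine (ContinuousLinearMap.compL 𝕜 𝔸 𝔸 E).aestronglyMeasurable_comp₂
      (L.flip.continuous.comp_aestronglyMeasurable hm) (Continuous.aestronglyMeasurable ?_)
    have h1 : Continuous fun t : ℝ => (t : 𝕜) • q₀ := by fun_prop
    exact (RCLike.continuous_ofReal (K := 𝕜)).smul ((hexp.continuous_fderiv one_ne_zero).comp h1)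
  · refine .of_forall fun t q hq => ?_
    have hq' : ‖q‖ ≤ ‖q₀‖ + 1 := by
      have := norm_le_norm_add_norm_sub' q q₀
      rw [Metric.mem_ball, dist_eq_norm] at hq
      linarith
    have hb : ∀ p : 𝔸, ‖p‖ ≤ ‖q₀‖ + 1 → ‖(t : 𝕜) • p‖ ≤ (‖q₀‖ + 1) * |t| := fun p hp => by
      rw [norm_smul, RCLike.norm_ofReal, mul_comm]; gcongr
    have h1 := norm_exp_sub_exp_le 𝕜 (hb q hq') (hb q₀ (by linarith))
    have h2 : |t| ≤ Real.exp |t| :=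
      (by linarith : |t| ≤ |t| + 1).trans (Real.add_one_le_exp _)
    rw [← smul_sub, norm_smul, RCLike.norm_ofReal] at h1
    rw [← sub_apply, ← map_sub]
    calc _ ≤ ‖L‖ * ‖NormedSpace.exp ((t : 𝕜) • q) - NormedSpace.exp ((t : 𝕜) • q₀)‖ * ‖φ t‖ :=
          L.le_opNorm₂ _ _
      _ ≤ ‖L‖ * (Real.exp ((‖q₀‖ + 1) * |t|) * (Real.exp |t| * ‖q - q₀‖)) * ‖φ t‖ := by
          gcongr
          exact h1.trans (by gcongr)
      _ = _ := by
          rw [show (‖q₀‖ + 2) * |t| = (‖q₀‖ + 1) * |t| + |t| by ring, Real.exp_add]; ring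
  · refine .of_forall fun t => ?_
    have h1 : HasFDerivAt (fun q : 𝔸 => NormedSpace.exp ((t : 𝕜) • q))
        ((t : 𝕜) • fderiv 𝕜 (NormedSpace.exp : 𝔸 → 𝔸) ((t : 𝕜) • q₀)) q₀ := by
      have h2 := ((hexp.differentiable (by norm_num)) ((t : 𝕜) • q₀)).hasFDerivAt
      have := h2.comp q₀ ((hasFDerivAt_id q₀).const_smul (t : 𝕜))
      convert! this using 1
      ext; simp
    exact (L.flip (φ t)).hasFDerivAt.comp q₀ h1

end Exp

/-! ### Mean value property against radial weights -/

section MeanValue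

variable {E : Type*} [NormedAddCommGroup E] [NormedSpace ℂ E] [CompleteSpace E]

/-- The mean value property against a radial weight. -/
theorem integral_radial_smul {G : ℂ → E} (hG : Differentiable ℂ G) {w : ℝ → ℝ}
    (hw : Continuous w) (hint : Integrable fun u : ℂ => w ‖u‖ • G u) :
    ∫ u : ℂ, w ‖u‖ • G u = (∫ u : ℂ, w ‖u‖) • G 0 := by
  set μ : Measure ℝ := volume.restrict (Set.uIoc 0 (2 * Real.pi)) with hμ
  set rot : ℝ → ℂ → ℂ := fun θ u => Complex.exp (θ * Complex.I) * u with hrot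
  have hnorm : ∀ θ u, ‖rot θ u‖ = ‖u‖ := fun θ u => by
    simp [hrot, Complex.norm_exp_ofReal_mul_I]
  have hmp : ∀ θ, MeasurePreserving (rot θ) (volume : Measure ℂ) volume := fun θ => by
    have h : rot θ = rotation (Circle.exp θ) := by ext u; simp [hrot, Circle.coe_exp]
    rw [h]
    exact (rotation (Circle.exp θ)).measurePreserving
  have hemb : ∀ θ, MeasurableEmbedding (rot θ) := fun θ => by
    have h : rot θ = (rotation (Circle.exp θ)).toHomeomorph := by
      ext u; simp [hrot, Circle.coe_exp]
    rw [h]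
    exact (rotation (Circle.exp θ)).toHomeomorph.measurableEmbedding
  have hrotc : Continuous fun p : ℝ × ℂ => rot p.1 p.2 := by fun_prop
  have hcont : Continuous fun p : ℝ × ℂ => w ‖p.2‖ • G (rot p.1 p.2) :=
    (hw.comp (by fun_prop)).smul (hG.continuous.comp hrotc)
  have hrotint : ∀ θ, Integrable (fun u => w ‖u‖ • G (rot θ u)) := fun θ => by
    have := ((hmp θ).integrable_comp_emb (hemb θ)).2 hint
    simpa [Function.comp_def, hnorm] using this
  have hrotval : ∀ (H : ℂ → E) θ, ∫ u, w ‖u‖ • H (rot θ u) = ∫ u : ℂ, w ‖u‖ • H u := fun H θ => by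
    have := (hmp θ).integral_comp (hemb θ) (fun u => w ‖u‖ • H u)
    simpa [hnorm] using this
  have hrotvaln : ∀ θ, ∫ u, ‖w ‖u‖ • G (rot θ u)‖ = ∫ u : ℂ, ‖w ‖u‖ • G u‖ := fun θ => by
    have := (hmp θ).integral_comp (hemb θ) (fun u => ‖w ‖u‖ • G u‖)
    simpa [hnorm] using this
  have hprod : Integrable (fun p : ℝ × ℂ => w ‖p.2‖ • G (rot p.1 p.2)) (μ.prod volume) := by
    refine (integrable_prod_iff hcont.aestronglyMeasurable).2
      ⟨.of_forall hrotint, ?_⟩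
    simp only [hrotvaln]
    have : IsFiniteMeasure μ := by rw [hμ, Set.uIoc]; infer_instance
    exact integrable_const _
  -- Integrating first over `u` gives `2π` times the integral, by rotation invariance. Integrating
  -- first over `θ` gives `2π • G 0`, by the mean value property on circles.
  have hsw := integral_integral_swap (μ := μ) (ν := (volume : Measure ℂ))
    (f := fun θ u => w ‖u‖ • G (rot θ u)) hprod
  have hmean : ∀ u, ∫ θ, G (rot θ u) ∂μ = (2 * Real.pi) • G 0 := by
    intro u
    have h1 : Real.circleAverage (fun z => G (z * u)) 0 1 = G 0 := by
      have : DiffContOnCl ℂ (fun z => G (z * u)) (Metric.ball 0 |1|) :=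
        (hG.comp (differentiable_id.mul_const u)).diffContOnCl
      simpa using this.circleAverage
    rw [← h1, Real.circleAverage_def, smul_smul, mul_inv_cancel₀ Real.two_pi_pos.ne', one_smul,
      intervalIntegral.integral_of_le Real.two_pi_pos.le, hμ,
      Set.uIoc_of_le Real.two_pi_pos.le]
    simp [circleMap, hrot]
  simp only [hrotval, integral_const, integral_smul, hmean] at hsw
  have hμu : μ.real Set.univ = 2 * Real.pi := by
    simp [hμ, Measure.real, Real.two_pi_pos.le, Real.pi_pos.le]
  rw [hμu, integral_smul_const, smul_comm] at hsw
  exact smul_right_injective E Real.two_pi_pos.ne' hsw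

end MeanValue

/-! ### Gaussian decay and density of `L¹ ∩ L²` -/

section Decay

variable {F : Type*} [NormedAddCommGroup F] [NormedSpace ℝ F]

theorem integrable_exp_neg_sq_add (c : ℝ) :
    Integrable fun t : ℝ => Real.exp (-t ^ 2 + c * t) := by
  have h := (integrable_cexp_quadratic' (b := -1) (by simp) (c : ℂ) 0).norm
  refine h.congr (.of_forall fun t => ?_)
  simp only [Complex.norm_exp]
  congr 1
  simp [← Complex.ofReal_pow]

theorem memLp_exp_gaussian (c : ℝ) : MemLp (fun t : ℝ => Real.exp (c * |t| - t ^ 2 / 2)) 2 := by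
  have hc : Continuous fun t : ℝ => Real.exp (c * |t| - t ^ 2 / 2) := by fun_prop
  rw [memLp_two_iff_integrable_sq_norm hc.aestronglyMeasurable]
  -- `e^{2c|t|} ≤ e^{2ct} + e^{-2ct}`.
  refine ((integrable_exp_neg_sq_add (2 * c)).add (integrable_exp_neg_sq_add (-(2 * c)))).mono'
    (by fun_prop) (.of_forall fun t => ?_)
  rw [norm_pow, norm_norm, Real.norm_of_nonneg (Real.exp_nonneg _), ← Real.exp_nat_mul]
  have h1 := Real.exp_nonneg (-t ^ 2 + 2 * c * t)
  have h2 := Real.exp_nonneg (-t ^ 2 + -(2 * c) * t)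
  rcases abs_cases t with ⟨h, _⟩ | ⟨h, _⟩ <;> rw [h] <;> simp only [Pi.add_apply]
  · refine le_trans (le_of_eq ?_) (le_add_of_nonneg_right h2)
    congr 1; push_cast; ring
  · refine le_trans (le_of_eq ?_) (le_add_of_nonneg_left h1)
    congr 1; push_cast; ring

/-- Cauchy-Schwarz; this is the decay hypothesis of `differentiable_integral_exp_smul`. -/
theorem integrable_exp_mul_norm_gaussian {ψ : ℝ → F} (hψ : MemLp ψ 2) (c : ℝ) :
    Integrable fun t : ℝ => Real.exp (c * |t|) * ‖Real.exp (-t ^ 2 / 2) • ψ t‖ := by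
  refine ((memLp_exp_gaussian c).integrable_mul hψ.norm).congr (.of_forall fun t => ?_)
  simp only [Pi.mul_apply]
  rw [norm_smul, Real.norm_of_nonneg (Real.exp_nonneg _), ← mul_assoc, ← Real.exp_add]
  ring_nf

theorem aestronglyMeasurable_gaussian_smul {ψ : ℝ → F} (hψ : AEStronglyMeasurable ψ) :
    AEStronglyMeasurable fun t : ℝ => Real.exp (-t ^ 2 / 2) • ψ t :=
  Continuous.aestronglyMeasurable (by fun_prop) |>.smul hψ

theorem dense_integrable {F : Type*} [NormedAddCommGroup F] :
    Dense {ψ : Lp F 2 (volume : Measure ℝ) | Integrable (ψ : ℝ → F)} := by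
  refine (Lp.simpleFunc.dense (E := F) (p := 2) (by norm_num)).mono fun f hf => ?_
  have h1 := Lp.simpleFunc.toSimpleFunc_eq_toFun (⟨f, hf⟩ : Lp.simpleFunc F 2 volume)
  have h2 := Lp.simpleFunc.memLp (⟨f, hf⟩ : Lp.simpleFunc F 2 volume)
  exact ((SimpleFunc.memLp_iff_integrable (by norm_num) (by norm_num)).1 h2).congr h1

end Decay

/-! ### The complex Bargmann transform: holomorphy and isometry -/

section Bargmann

variable {E : Type*} [NormedAddCommGroup E] [InnerProductSpace ℂ E]

/-- The normalising constant `π^{-3/4}`. -/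
def kappa : ℝ := (1 / Real.pi) ^ (3 / 4 : ℝ)

theorem kappa_pos : 0 < kappa := Real.rpow_pos_of_pos (by positivity) _

theorem kappa_sq_mul : kappa ^ 2 * (Real.pi * √Real.pi) = 1 := by
  have hp := Real.pi_pos
  rw [kappa, ← Real.rpow_natCast, ← Real.rpow_mul (by positivity), Real.sqrt_eq_rpow,
    Real.div_rpow zero_le_one hp.le, Real.one_rpow]
  nth_rewrite 2 [← Real.rpow_one Real.pi]
  rw [← Real.rpow_add hp, one_div_mul_eq_div, ← Real.rpow_sub hp]
  norm_num

/-- The complex Bargmann kernel. -/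
def kern (z : ℂ) (t : ℝ) : ℂ :=
  kappa * Complex.exp (-(z ^ 2 + t ^ 2) / 2 + √2 * (z * t))

theorem continuous_kern (z : ℂ) : Continuous (kern z) := by
  unfold kern; fun_prop

/-- Splits off a factor in `z` alone and a Gaussian in `t`, leaving a Laplace kernel. -/
theorem kern_eq (z : ℂ) (t : ℝ) :
    kern z t = (kappa * Complex.exp (-z ^ 2 / 2)) *
      (Complex.exp (t * (√2 * z)) * (Real.exp (-t ^ 2 / 2) : ℝ)) := by
  rw [kern, mul_assoc]
  push_cast
  rw [← Complex.exp_add, ← Complex.exp_add]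
  ring_nf

theorem memLp_kern (z : ℂ) : MemLp (kern z) 2 := by
  refine ((memLp_exp_gaussian ‖√2 * z‖).const_mul
    ‖(kappa * Complex.exp (-z ^ 2 / 2))‖).mono (continuous_kern z).aestronglyMeasurable
    (.of_forall fun t => ?_)
  rw [kern_eq, norm_mul, norm_mul (‖_‖), norm_norm]
  gcongr ?_ * ?_
  rw [norm_mul, Real.norm_of_nonneg (Real.exp_nonneg _), Complex.norm_real,
    Real.norm_of_nonneg (Real.exp_nonneg _), sub_eq_add_neg, Real.exp_add, ← neg_div]
  gcongr
  refine (Complex.norm_exp_le_exp_norm _).trans (Real.exp_le_exp.2 (le_of_eq ?_))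
  rw [norm_mul, Complex.norm_real, Real.norm_eq_abs, mul_comm]

/-- The Bargmann transform of functions with values in a complex Hilbert space. -/
def cB (ψ : ℝ → E) (z : ℂ) : E := ∫ t : ℝ, kern z t • ψ t

theorem integrable_kern_smul {ψ : ℝ → E} (hψ : MemLp ψ 2) (z : ℂ) :
    Integrable fun t => kern z t • ψ t :=
  memLp_one_iff_integrable.1 (hψ.smul (memLp_kern z))

theorem cB_congr {ψ φ : ℝ → E} (h : ψ =ᵐ[volume] φ) : cB ψ = cB φ := by
  ext z
  exact integral_congr_ae (by filter_upwards [h] with t ht; rw [ht])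

theorem cB_add [CompleteSpace E] {ψ φ : ℝ → E} (hψ : MemLp ψ 2) (hφ : MemLp φ 2) :
    cB (ψ + φ) = cB ψ + cB φ := by
  ext z
  simp only [cB, Pi.add_apply, smul_add]
  exact integral_add (integrable_kern_smul hψ z) (integrable_kern_smul hφ z)

theorem cB_smul (c : ℂ) (ψ : ℝ → E) : cB (c • ψ) = c • cB ψ := by
  ext z
  simp only [cB, Pi.smul_apply, smul_comm _ c]
  exact integral_smul _ _

theorem cB_eq (ψ : ℝ → E) (z : ℂ) :
    cB ψ z = (kappa * Complex.exp (-z ^ 2 / 2)) •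
      ∫ t : ℝ, Complex.exp (t * (√2 * z)) • (Real.exp (-t ^ 2 / 2) • ψ t) := by
  rw [cB, ← integral_smul]
  refine integral_congr_ae (.of_forall fun t => ?_)
  simp only
  rw [kern_eq, mul_smul, mul_smul (Complex.exp _), Complex.coe_smul]

theorem differentiable_cB [CompleteSpace E] {ψ : ℝ → E} (hψ : MemLp ψ 2) :
    Differentiable ℂ (cB ψ) := by
  have h := differentiable_integral_exp_smul (𝕜 := ℂ) (𝔸 := ℂ)
    (ContinuousLinearMap.lsmul ℂ ℂ : ℂ →L[ℂ] E →L[ℂ] E)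
    (aestronglyMeasurable_gaussian_smul hψ.1) (integrable_exp_mul_norm_gaussian hψ)
  have h2 := h.comp (g := _) (f := fun z : ℂ => √2 * z) (by fun_prop)
  have h3 : Differentiable ℂ fun z : ℂ => (kappa : ℂ) * Complex.exp (-z ^ 2 / 2) := by fun_prop
  have h4 : cB ψ = _ := funext (cB_eq ψ)
  rw [h4, Complex.exp_eq_exp_ℂ]
  rw [Complex.exp_eq_exp_ℂ] at h3
  exact h3.smul h2

/-- The Bargmann transform, multiplied by the Gaussian weight. -/
def wB (ψ : ℝ → E) (z : ℂ) : E := Real.exp (-‖z‖ ^ 2 / 2) • cB ψ z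

/-- For fixed `x` the exponent is linear in `y` apart from a factor free of `t`, so `y` enters the
integral only as a Fourier variable. -/
theorem cB_vertical [CompleteSpace E] (ψ : ℝ → E) (x y : ℝ) :
    cB ψ (x + y * Complex.I) = (kappa * Complex.exp (-(x + y * Complex.I) ^ 2 / 2)) •
      fourierC (fun t => Real.exp (-t ^ 2 / 2 + √2 * x * t) • ψ t) (√2 * y) := by
  rw [cB_eq, fourierC]
  congr 1
  refine integral_congr_ae (.of_forall fun t => ?_)
  simp only [← Complex.coe_smul, smul_smul]
  push_cast
  rw [← Complex.exp_add, ← Complex.exp_add]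
  ring_nf

/-- The weight `e^{-|z|²/2}` times `|e^{-z²/2}|` is `e^{-x²}`: the `y²` terms cancel, so Plancherel
in `y` becomes applicable. -/
theorem enorm_wB_vertical [CompleteSpace E] (ψ : ℝ → E) (x y : ℝ) :
    ‖wB ψ (x + y * Complex.I)‖ₑ ^ 2 = ENNReal.ofReal (kappa ^ 2 * Real.exp (-2 * x ^ 2)) *
      ‖fourierC (fun t => Real.exp (-t ^ 2 / 2 + √2 * x * t) • ψ t) (√2 * y)‖ₑ ^ 2 := by
  rw [wB, cB_vertical, enorm_smul, enorm_smul, ← mul_assoc, mul_pow]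
  congr 1
  rw [← ofReal_norm, ← ofReal_norm, ← ENNReal.ofReal_mul (norm_nonneg _),
    ← ENNReal.ofReal_pow (by positivity)]
  congr 1
  rw [norm_mul, Complex.norm_real, Real.norm_of_nonneg kappa_pos.le,
    Real.norm_of_nonneg (Real.exp_nonneg _), Complex.norm_exp, mul_left_comm, mul_pow,
    ← Real.exp_add, ← Real.exp_nat_mul]
  congr 2
  have h1 : ‖(x : ℂ) + y * Complex.I‖ ^ 2 = x ^ 2 + y ^ 2 := by
    rw [← Complex.normSq_eq_norm_sq, Complex.normSq_add_mul_I]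
  have h2 : (-((x : ℂ) + y * Complex.I) ^ 2 / 2).re = (-x ^ 2 + y ^ 2) / 2 := by
    have : -((x : ℂ) + y * Complex.I) ^ 2 / 2
        = (((-x ^ 2 + y ^ 2) / 2 : ℝ) : ℂ) + ((-x * y : ℝ) : ℂ) * Complex.I := by
      push_cast
      linear_combination (-(y : ℂ) ^ 2 / 2) * Complex.I_sq
    rw [this]; rw [Complex.add_re, Complex.ofReal_re, Complex.re_ofReal_mul]; simp
  rw [h1, h2]
  push_cast
  ring

theorem aestronglyMeasurable_exp_smul {ψ : ℝ → E} (hψ : MemLp ψ 2) (c : ℝ) :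
    AEStronglyMeasurable fun t : ℝ => Real.exp (-t ^ 2 / 2 + c * t) • ψ t := by
  have h : Continuous fun t : ℝ => Real.exp (-t ^ 2 / 2 + c * t) := by fun_prop
  exact h.aestronglyMeasurable.smul hψ.1

theorem memLp_gaussian_smul [CompleteSpace E] {ψ : ℝ → E} (hψ : MemLp ψ 2) (c : ℝ) :
    MemLp (fun t : ℝ => Real.exp (-t ^ 2 / 2 + c * t) • ψ t) 2 := by
  refine (hψ.const_smul (Real.exp (c ^ 2 / 2))).mono
    (aestronglyMeasurable_exp_smul hψ c) (.of_forall fun t => ?_)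
  simp only [Pi.smul_apply, norm_smul, Real.norm_of_nonneg (Real.exp_nonneg _)]
  gcongr
  nlinarith [sq_nonneg (c - t)]

theorem integrable_gaussian_smul [CompleteSpace E] {ψ : ℝ → E} (hψ : MemLp ψ 2) (c : ℝ) :
    Integrable fun t : ℝ => Real.exp (-t ^ 2 / 2 + c * t) • ψ t := by
  refine (integrable_exp_mul_norm_gaussian hψ |c|).mono'
    (aestronglyMeasurable_exp_smul hψ c) (.of_forall fun t => ?_)
  rw [norm_smul, norm_smul, ← mul_assoc]
  simp only [Real.norm_of_nonneg (Real.exp_nonneg _)]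
  rw [← Real.exp_add]
  gcongr ?_ * _
  refine Real.exp_le_exp.2 ?_
  rw [← abs_mul, add_comm]
  exact add_le_add (le_abs_self _) le_rfl

theorem continuous_wB [CompleteSpace E] {ψ : ℝ → E} (hψ : MemLp ψ 2) : Continuous (wB ψ) :=
  Continuous.smul (f := fun z : ℂ => Real.exp (-‖z‖ ^ 2 / 2)) (by fun_prop)
    (differentiable_cB hψ).continuous

theorem lintegral_complex_eq {f : ℂ → ENNReal} (hf : Measurable f) :
    ∫⁻ z, f z = ∫⁻ x : ℝ, ∫⁻ y : ℝ, f (x + y * Complex.I) := by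
  rw [← (Complex.volume_preserving_equiv_real_prod.symm).lintegral_comp hf,
    Measure.volume_eq_prod, lintegral_prod
      (fun a : ℝ × ℝ => f (Complex.measurableEquivRealProd.symm a))
      (hf.comp Complex.measurableEquivRealProd.symm.measurable).aemeasurable]
  simp only [Complex.measurableEquivRealProd_symm_apply, Complex.mk_eq_add_mul_I]

theorem lintegral_gaussian_shift (t : ℝ) :
    ∫⁻ x : ℝ, ENNReal.ofReal (Real.exp (-(√2 * x - t) ^ 2)) = ENNReal.ofReal √(Real.pi / 2) := by
  have h2 : (√2 : ℝ) ^ 2 = 2 := Real.sq_sqrt (by norm_num)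
  have h : ∀ x : ℝ, Real.exp (-(√2 * x - t) ^ 2) = Real.exp (-2 * (x - t / √2) ^ 2) := by
    intro x
    congr 1
    have : √2 * x - t = √2 * (x - t / √2) := by field_simp
    rw [this, mul_pow, h2]; ring
  simp_rw [h]
  rw [← ofReal_integral_eq_lintegral_ofReal
    ((integrable_exp_neg_mul_sq (b := 2) (by norm_num)).comp_sub_right _)
    (.of_forall fun _ => Real.exp_nonneg _),
    integral_sub_right_eq_self (fun x : ℝ => Real.exp (-2 * x ^ 2)), integral_gaussian]

/-- Plancherel in `y`, then Tonelli. The remaining integral in `x` is a Gaussian centred at `t/√2`,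
whose mass does not depend on `t`; `kappa` normalises the total constant to `1`. -/
theorem lintegral_enorm_wB [CompleteSpace E] {ψ : ℝ → E} (hψ : MemLp ψ 2) :
    ∫⁻ z, ‖wB ψ z‖ₑ ^ 2 = ∫⁻ t, ‖ψ t‖ₑ ^ 2 := by
  have hs2 : (√2 : ℝ) ^ 2 = 2 := Real.sq_sqrt (by norm_num)
  have hs2' : √2 ≠ 0 := by positivity
  rw [lintegral_complex_eq ((continuous_wB hψ).enorm.measurable.pow_const 2)]
  -- `√2 π` is Plancherel's `2π` divided by the `√2` of the dilation `y ↦ √2 y`.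
  set C : ℝ := kappa ^ 2 * (√2 * Real.pi) with hC
  have hinner : ∀ x : ℝ, ∫⁻ y : ℝ, ‖wB ψ (x + y * Complex.I)‖ₑ ^ 2
      = ∫⁻ t : ℝ, ENNReal.ofReal (C * Real.exp (-(√2 * x - t) ^ 2)) * ‖ψ t‖ₑ ^ 2 := by
    intro x
    simp_rw [enorm_wB_vertical]
    rw [lintegral_const_mul' _ _ ENNReal.ofReal_ne_top, lintegral_comp_mul_left hs2',
      lintegral_enorm_fourierC (integrable_gaussian_smul hψ _) (memLp_gaussian_smul hψ _),
      ← mul_assoc, ← mul_assoc, ← ENNReal.ofReal_mul (by positivity),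
      ← ENNReal.ofReal_mul (by positivity), ← lintegral_const_mul' _ _ ENNReal.ofReal_ne_top]
    congr 1 with t
    rw [enorm_smul, mul_pow, ← mul_assoc, Real.enorm_of_nonneg (Real.exp_nonneg _),
      ← ENNReal.ofReal_pow (Real.exp_nonneg _), ← ENNReal.ofReal_mul (by positivity)]
    congr 2
    rw [← Real.exp_nat_mul, hC, abs_of_pos (by positivity)]
    have e1 : -(√2 * x - t) ^ 2 = -2 * x ^ 2 + (2 : ℕ) * (-t ^ 2 / 2 + √2 * x * t) := by
      push_cast; linear_combination (-x ^ 2) * hs2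
    rw [e1, Real.exp_add]
    field_simp
    rw [hs2]
  simp_rw [hinner]
  have hm : AEMeasurable (fun p : ℝ × ℝ => ENNReal.ofReal (C * Real.exp (-(√2 * p.1 - p.2) ^ 2))
      * ‖ψ p.2‖ₑ ^ 2) (volume.prod volume) := by
    refine AEMeasurable.mul (by fun_prop) ((hψ.1.enorm.pow_const 2).comp_quasiMeasurePreserving
      Measure.quasiMeasurePreserving_snd)
  rw [lintegral_lintegral_swap hm]
  refine lintegral_congr_ae ?_
  filter_upwards [] with t
  rw [lintegral_mul_const'' _ (by fun_prop)]
  have hC0 : 0 ≤ C := by have := kappa_pos; positivity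
  simp_rw [ENNReal.ofReal_mul hC0]
  rw [lintegral_const_mul' _ _ ENNReal.ofReal_ne_top, lintegral_gaussian_shift,
    ← ENNReal.ofReal_mul hC0]
  have : C * √(Real.pi / 2) = 1 := by
    rw [Real.sqrt_div Real.pi_pos.le, hC, ← kappa_sq_mul]; field_simp
  rw [this, ENNReal.ofReal_one, one_mul]

end Bargmann

/-! ### The complex Bargmann transform: range and intertwining with Fourier -/

section Bargmann

variable {E : Type*} [NormedAddCommGroup E] [InnerProductSpace ℂ E]

open scoped ComplexConjugate InnerProductSpace

theorem eLpNorm_wB [CompleteSpace E] {ψ : ℝ → E} (hψ : MemLp ψ 2) :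
    eLpNorm (wB ψ) 2 volume = eLpNorm ψ 2 volume := by
  have h := lintegral_enorm_wB hψ
  rw [← eLpNorm_two_sq, ← eLpNorm_two_sq] at h
  exact (ENNReal.pow_right_strictMono two_ne_zero).injective h

theorem memLp_wB [CompleteSpace E] {ψ : ℝ → E} (hψ : MemLp ψ 2) : MemLp (wB ψ) 2 :=
  ⟨(continuous_wB hψ).aestronglyMeasurable, by rw [eLpNorm_wB hψ]; exact hψ.2⟩

variable (E) in
/-- The weighted Bargmann transform as a bounded operator `L²(ℝ; E) → L²(ℂ; E)`. -/
def wBL2 [CompleteSpace E] : Lp E 2 (volume : Measure ℝ) →L[ℂ] Lp E 2 (volume : Measure ℂ) :=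
  LinearMap.mkContinuous
    { toFun := fun ψ => (memLp_wB (Lp.memLp ψ)).toLp _
      map_add' := fun ψ φ => by
        rw [← MemLp.toLp_add]
        refine MemLp.toLp_congr _ _ (.of_forall fun z => ?_)
        simp only [wB, Pi.add_apply]
        rw [cB_congr (Lp.coeFn_add ψ φ), cB_add (Lp.memLp ψ) (Lp.memLp φ), Pi.add_apply, smul_add]
      map_smul' := fun a ψ => by
        rw [RingHom.id_apply, ← MemLp.toLp_const_smul]
        refine MemLp.toLp_congr _ _ (.of_forall fun z => ?_)
        simp only [wB, Pi.smul_apply]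
        rw [cB_congr (Lp.coeFn_smul a ψ), cB_smul, Pi.smul_apply, smul_comm] }
    1
    (fun ψ => by
      simp only [LinearMap.coe_mk, AddHom.coe_mk]
      rw [Lp.norm_toLp, eLpNorm_wB (Lp.memLp ψ), one_mul, Lp.norm_def])

theorem coeFn_wBL2 [CompleteSpace E] (ψ : Lp E 2 (volume : Measure ℝ)) :
    (wBL2 E ψ : ℂ → E) =ᵐ[volume] wB (ψ : ℝ → E) :=
  MemLp.coeFn_toLp (memLp_wB (Lp.memLp ψ))

theorem ae_eq_zero_of_cB_eq_zero [CompleteSpace E] {ψ : ℝ → E} (hψ : MemLp ψ 2) (h : cB ψ = 0) :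
    ψ =ᵐ[volume] 0 := by
  have h1 := eLpNorm_wB hψ
  have h2 : wB ψ = 0 := by ext z; simp [wB, h]
  rw [h2, eLpNorm_zero] at h1
  exact (eLpNorm_eq_zero_iff hψ.1 (by norm_num)).1 h1.symm

theorem conj_kern (w : ℂ) (t : ℝ) : conj (kern w t) = kern (conj w) t := by
  simp only [kern, map_mul, Complex.conj_ofReal, ← Complex.exp_conj]
  simp [map_div₀, Complex.conj_ofNat]

/-- The coherent states. -/
def coherent (w : ℂ) (e : E) (t : ℝ) : E := kern (conj w) t • e

theorem memLp_coherent (w : ℂ) (e : E) : MemLp (coherent w e) 2 :=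
  ((ContinuousLinearMap.toSpanSingleton ℂ e).comp_memLp' (memLp_kern (conj w)))

/-- Evaluation at `w` is a pairing with a coherent state, hence continuous in the `L²` norm. Both
surjectivity and the density argument rest on this. -/
theorem inner_coherent [CompleteSpace E] (w : ℂ) (e : E) (ψ : Lp E 2 (volume : Measure ℝ)) :
    ⟪(memLp_coherent w e).toLp _, ψ⟫_ℂ = ⟪e, cB (ψ : ℝ → E) w⟫_ℂ := by
  rw [L2.inner_def, cB, ← integral_inner (integrable_kern_smul (Lp.memLp ψ) w)]
  refine integral_congr_ae ?_
  filter_upwards [(memLp_coherent w e).coeFn_toLp] with t ht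
  rw [ht, coherent, inner_smul_left, inner_smul_right, conj_kern, Complex.conj_conj]

/-- Completing the square. Through `cB_coherent`, coherent states are sent to reproducing kernels.
-/
theorem integral_kern_mul_kern (z w : ℂ) :
    ∫ t : ℝ, kern z t * kern w t = (Real.pi : ℂ)⁻¹ * Complex.exp (z * w) := by
  have h := integral_cexp_quadratic (b := -1) (by simp) (√2 * (z + w)) (-(z ^ 2 + w ^ 2) / 2)
  have hs : ((√2 : ℝ) : ℂ) ^ 2 = 2 := by norm_cast; exact Real.sq_sqrt (by norm_num)
  have h1 : ∀ t : ℝ, kern z t * kern w t = (kappa : ℂ) ^ 2 *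
      Complex.exp (-1 * t ^ 2 + √2 * (z + w) * t + -(z ^ 2 + w ^ 2) / 2) := by
    intro t
    rw [kern, kern, mul_mul_mul_comm, ← Complex.exp_add, ← sq]
    ring_nf
  simp_rw [h1]
  rw [integral_const_mul, h]
  have h2 : ((Real.pi : ℂ) / - -1) ^ (1 / 2 : ℂ) = ((√Real.pi : ℝ) : ℂ) := by
    rw [neg_neg, div_one, Real.sqrt_eq_rpow, Complex.ofReal_cpow Real.pi_pos.le]
    norm_num
  have h3 : -(z ^ 2 + w ^ 2) / 2 - (√2 * (z + w)) ^ 2 / (4 * (-1)) = z * w := by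
    linear_combination (z + w) ^ 2 / 4 * hs
  rw [h2, h3, ← mul_assoc]
  congr 1
  apply eq_inv_of_mul_eq_one_left
  have := kappa_sq_mul
  rw [mul_assoc, mul_comm (√Real.pi : ℂ)]
  exact_mod_cast this

theorem cB_coherent [CompleteSpace E] (w : ℂ) (e : E) (z : ℂ) :
    cB (coherent w e) z = ((Real.pi : ℂ)⁻¹ * Complex.exp (z * conj w)) • e := by
  rw [cB, ← integral_kern_mul_kern, ← integral_smul_const]
  simp only [coherent, smul_smul]

/-- The reproducing property of the Fock space. -/
theorem integral_reproducing {H : ℂ → ℂ} (hH : Differentiable ℂ H) (w : ℂ)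
    (hint : Integrable fun z : ℂ => Real.exp (-‖z‖ ^ 2) • (Complex.exp (conj z * w) * H z)) :
    ∫ z : ℂ, Real.exp (-‖z‖ ^ 2) • (Complex.exp (conj z * w) * H z) = Real.pi * H w := by
  -- Translation by `w` turns the weight into the radial `e^{-|u|²}` times a factor holomorphic in
  -- `u`. The mean value property then yields `G 0 = H w`, and `π` is the mass of the Gaussian.
  set G : ℂ → ℂ := fun u => Complex.exp (-(conj w * u)) * H (u + w) with hG
  have hGd : Differentiable ℂ G := by
    have : Differentiable ℂ fun u => H (u + w) := hH.comp (by fun_prop)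
    exact Differentiable.mul (by fun_prop) this
  have hshift : ∀ u : ℂ, Real.exp (-‖u + w‖ ^ 2) • (Complex.exp (conj (u + w) * w) * H (u + w))
      = Real.exp (-‖u‖ ^ 2) • G u := by
    intro u
    simp only [hG, Complex.real_smul, ← mul_assoc]
    congr 1
    push_cast
    rw [← Complex.exp_add, ← Complex.exp_add]
    congr 1
    have hn : ∀ v : ℂ, ((‖v‖ : ℂ)) ^ 2 = v * conj v := fun v => (Complex.mul_conj' v).symm
    rw [hn, hn, map_add]
    ring
  have h1 := integral_add_right_eq_self (μ := (volume : Measure ℂ))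
    (fun z : ℂ => Real.exp (-‖z‖ ^ 2) • (Complex.exp (conj z * w) * H z)) w
  have h2 := hint.comp_add_right w
  simp only [hshift] at h1 h2
  rw [← h1, integral_radial_smul (w := fun r => Real.exp (-r ^ 2)) hGd (by fun_prop) h2]
  have h3 := GaussianFourier.integral_rexp_neg_mul_sq_norm (V := ℂ) (b := 1) one_pos
  simp only [Complex.finrank_real_complex, neg_mul, one_mul] at h3
  rw [h3]
  simp [hG]

/-- Every entire function in the Fock space is a Bargmann transform. -/
theorem exists_cB_eq [CompleteSpace E] {F : ℂ → E} (hF : Differentiable ℂ F)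
    (hF2 : MemLp (fun z : ℂ => Real.exp (-‖z‖ ^ 2 / 2) • F z) 2) :
    ∃ ψ : Lp E 2 (volume : Measure ℝ), cB (ψ : ℝ → E) = F := by
  -- Pairing the transform of this candidate at `w` with `e` equals pairing the weighted `F` with
  -- the transformed coherent state, which is the reproducing integral for `⟪e, F ·⟫`.
  refine ⟨ContinuousLinearMap.adjoint (wBL2 E) (hF2.toLp _), ?_⟩
  ext w
  refine ext_inner_left ℂ fun e => ?_
  rw [← inner_coherent, ContinuousLinearMap.adjoint_inner_right]
  have hw : ∀ᵐ z : ℂ, ⟪wBL2 E ((memLp_coherent w e).toLp _) z, hF2.toLp _ z⟫_ℂ =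
      (Real.pi : ℂ)⁻¹ * (Real.exp (-‖z‖ ^ 2) • (Complex.exp (conj z * w) * ⟪e, F z⟫_ℂ)) := by
    filter_upwards [coeFn_wBL2 ((memLp_coherent w e).toLp _), hF2.coeFn_toLp] with z h1 h2
    rw [h1, h2, wB, cB_congr (memLp_coherent w e).coeFn_toLp, cB_coherent,
      ← Complex.coe_smul, ← Complex.coe_smul, smul_smul, inner_smul_left, inner_smul_right,
      Complex.real_smul]
    simp only [map_mul, Complex.conj_ofReal, map_inv₀, ← Complex.exp_conj, Complex.conj_conj]
    have : Real.exp (-‖z‖ ^ 2) = Real.exp (-‖z‖ ^ 2 / 2) * Real.exp (-‖z‖ ^ 2 / 2) := by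
      rw [← Real.exp_add]; ring_nf
    rw [this]
    push_cast
    ring
  have hpi : (Real.pi : ℂ) ≠ 0 := by exact_mod_cast Real.pi_ne_zero
  have hint := (L2.integrable_inner (𝕜 := ℂ) (wBL2 E ((memLp_coherent w e).toLp _))
    (hF2.toLp _)).congr hw
  have hint' := hint.const_mul (Real.pi : ℂ)
  simp only [mul_inv_cancel_left₀ hpi] at hint'
  rw [L2.inner_def, integral_congr_ae hw, integral_const_mul, integral_reproducing
    (H := fun z => ⟪e, F z⟫_ℂ) ((innerSL ℂ e).differentiable.comp hF) w hint',
    inv_mul_cancel_left₀ hpi]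

/-- Completing the square; this Gaussian identity is the source of both the rotation and the factor
`√(2π)`. -/
theorem integral_kern_mul_exp (x y : ℝ) :
    ∫ t : ℝ, kern x t * Complex.exp (Complex.I * t * y) =
      (√(2 * Real.pi) : ℝ) * kern (Complex.I * x) y := by
  have h := integral_cexp_quadratic (b := -(1 / 2)) (by norm_num) (√2 * x + Complex.I * y)
    (-(x ^ 2) / 2)
  have hs : ((√2 : ℝ) : ℂ) ^ 2 = 2 := by norm_cast; exact Real.sq_sqrt (by norm_num)
  have h1 : ∀ t : ℝ, kern x t * Complex.exp (Complex.I * t * y) = (kappa : ℂ) *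
      Complex.exp (-(1 / 2) * t ^ 2 + (√2 * x + Complex.I * y) * t + -(x ^ 2) / 2) := by
    intro t
    rw [kern, mul_assoc, ← Complex.exp_add]
    ring_nf
  simp_rw [h1]
  rw [integral_const_mul, h, kern, mul_left_comm]
  have h2 : ((Real.pi : ℂ) / - -(1 / 2)) ^ (1 / 2 : ℂ) = ((√(2 * Real.pi) : ℝ) : ℂ) := by
    rw [neg_neg, Real.sqrt_eq_rpow, Complex.ofReal_cpow (by positivity)]
    push_cast
    ring_nf
  rw [h2]
  congr 3
  linear_combination (x : ℂ) ^ 2 / 2 * hs + (x ^ 2 / 2 + (y : ℂ) ^ 2 / 2) * Complex.I_sq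

/-- The Bargmann transform of a Fourier transform, for integrable functions. -/
theorem cB_fourierC [CompleteSpace E] {ψ : ℝ → E} (hψ : Integrable ψ) (x : ℝ) :
    cB (fourierC ψ) x = √(2 * Real.pi) • cB ψ (Complex.I * x) := by
  have hk : Integrable (kern x) := by
    have h := integrable_cexp_quadratic' (b := -(1 / 2)) (by norm_num) (√2 * x)
      (-(x ^ 2) / 2)
    refine (h.const_mul (kappa : ℂ)).congr (.of_forall fun t => ?_)
    simp only [kern]
    ring_nf
  have hprod : Integrable (fun p : ℝ × ℝ =>
      kern x p.1 • Complex.exp (Complex.I * p.1 * p.2) • ψ p.2) (volume.prod volume) := by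
    have h0 := hk.smul_prod hψ
    refine h0.mono ?_ (.of_forall fun p => ?_)
    · have hc : Continuous fun p : ℝ × ℝ => Complex.exp (Complex.I * p.1 * p.2) := by fun_prop
      refine (hc.aestronglyMeasurable.smul h0.1).congr (.of_forall fun p => ?_)
      exact smul_comm _ _ _
    · rw [norm_smul, norm_smul, norm_smul, show Complex.I * p.1 * p.2
        = ((p.1 * p.2 : ℝ) : ℂ) * Complex.I by push_cast; ring,
        Complex.norm_exp_ofReal_mul_I, one_mul]
  simp only [cB, fourierC]
  rw [← integral_smul]
  simp_rw [← integral_smul (kern _ _)]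
  rw [integral_integral_swap hprod]
  refine integral_congr_ae (.of_forall fun y => ?_)
  simp only [smul_smul]
  rw [integral_smul_const, integral_kern_mul_exp, mul_smul, Complex.coe_smul]

/-- The Bargmann transform intertwines the Fourier transform with the rotation by `i`. -/
theorem cB_fourierCL2 [CompleteSpace E] (ψ : Lp E 2 (volume : Measure ℝ)) (x : ℝ) :
    cB (fourierCL2 E ψ : ℝ → E) x = √(2 * Real.pi) • cB (ψ : ℝ → E) (Complex.I * x) := by
  refine ext_inner_left ℂ fun e => ?_
  rw [← Complex.coe_smul, inner_smul_right, ← inner_coherent, ← inner_coherent]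
  have hcont1 : Continuous fun ψ : Lp E 2 (volume : Measure ℝ) =>
      ⟪(memLp_coherent (x : ℂ) e).toLp _, fourierCL2 E ψ⟫_ℂ :=
    continuous_const.inner (fourierCL2 E).continuous
  have hcont2 : Continuous fun ψ : Lp E 2 (volume : Measure ℝ) =>
      ((√(2 * Real.pi) : ℝ) : ℂ) * ⟪(memLp_coherent (Complex.I * x) e).toLp _, ψ⟫_ℂ :=
    continuous_const.mul (continuous_const.inner continuous_id)
  refine congrFun (hcont1.ext_on dense_integrable hcont2 fun φ hφ => ?_) ψ
  simp only
  rw [inner_coherent, inner_coherent, cB_congr (coeFn_fourierCL2 φ hφ), cB_fourierC hφ,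
    ← Complex.coe_smul, inner_smul_right]

end Bargmann

/-! ### Slices of `ℍ` as complex Hilbert spaces -/

section SliceModule

theorem mul_self_of_mem {I : ℍ[ℝ]} (hI : I ∈ imagUnits) : I * I = -1 := by
  rw [← sq]; exact hI

theorem norm_of_mem {I : ℍ[ℝ]} (hI : I ∈ imagUnits) : ‖I‖ = 1 := by
  have h := congrArg norm (mul_self_of_mem hI)
  rw [norm_mul, norm_neg, norm_one] at h
  nlinarith [norm_nonneg I]

theorem re_of_mem {I : ℍ[ℝ]} (hI : I ∈ imagUnits) : I.re = 0 := by
  rw [← Quaternion.sq_eq_neg_normSq, Quaternion.normSq_eq_norm_mul_self, norm_of_mem hI]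
  simpa using! hI

/-- The embedding of `ℂ` onto the slice `ℂ_I`. -/
def embed (I : imagUnits) : ℂ →ₐ[ℝ] ℍ[ℝ] :=
  Complex.lift ⟨I.1, mul_self_of_mem I.2⟩

theorem embed_eq_slicePt (I : imagUnits) (z : ℂ) : embed I z = slicePt I z.re z.im := by
  simp only [embed, Complex.lift_apply, Complex.liftAux_apply, slicePt]
  rw [← Quaternion.coe_mul_eq_smul]
  rfl

theorem embed_mk (I : imagUnits) (x y : ℝ) : embed I ⟨x, y⟩ = slicePt I x y :=
  embed_eq_slicePt I _

theorem embed_I (I : imagUnits) : embed I Complex.I = I := by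
  rw [embed_eq_slicePt]; simp [slicePt]

theorem embed_ofReal (I : imagUnits) (x : ℝ) : embed I x = (x : ℍ[ℝ]) := by
  rw [embed_eq_slicePt]; simp [slicePt]

theorem norm_embed (I : imagUnits) (z : ℂ) : ‖embed I z‖ = ‖z‖ := by
  have h1 := norm_of_mem I.2
  have h2 := re_of_mem I.2
  have h3 : Quaternion.normSq (I : ℍ[ℝ]) = 1 := by
    rw [Quaternion.normSq_eq_norm_mul_self, h1, one_mul]
  rw [Quaternion.normSq_def', h2] at h3
  rw [← sq_eq_sq₀ (norm_nonneg _) (norm_nonneg _), sq, ← Quaternion.normSq_eq_norm_mul_self,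
    ← Complex.normSq_eq_norm_sq, Complex.normSq_apply, embed_eq_slicePt, slicePt,
    Quaternion.normSq_def']
  simp [Quaternion.re_mul, h2]
  linear_combination z.im ^ 2 * h3

theorem continuous_embed (I : imagUnits) : Continuous (embed I) :=
  (embed I).toLinearMap.continuous_of_finiteDimensional

/-- The quaternions as a complex Hilbert space, with `i` acting as left multiplication by `I`. -/
def SliceMod (_ : imagUnits) : Type := ℍ[ℝ]

variable (I : imagUnits)

instance : NormedAddCommGroup (SliceMod I) := inferInstanceAs (NormedAddCommGroup ℍ[ℝ])

instance : CompleteSpace (SliceMod I) := inferInstanceAs (CompleteSpace ℍ[ℝ])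

instance : Module ℂ (SliceMod I) := Module.compHom ℍ[ℝ] (embed I).toRingHom

instance : NormedSpace ℂ (SliceMod I) where
  norm_smul_le z q := by
    rw [← norm_embed I z]
    exact norm_mul_le (embed I z) (q : ℍ[ℝ])

/-- The quaternionic norm satisfies the parallelogram law, so polarization supplies the complex
inner product; its formula is never needed. -/
instance : InnerProductSpace ℂ (SliceMod I) :=
  InnerProductSpace.ofNorm ℂ fun x y => by
    have h : ∀ a b : ℍ[ℝ], ‖a + b‖ * ‖a + b‖ + ‖a - b‖ * ‖a - b‖
        = 2 * (‖a‖ * ‖a‖ + ‖b‖ * ‖b‖) := fun a b => by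
      simpa only [sq] using parallelogram_law_with_norm ℝ a b
    exact h x y

/-- The identity map from `ℍ` to `SliceMod I`. -/
def toSlice : ℍ[ℝ] ≃ₗᵢ[ℝ] SliceMod I where
  toFun q := q
  invFun q := q
  map_add' _ _ := rfl
  map_smul' r q := by
    change r • q = embed I (r : ℂ) * q
    rw [embed_ofReal, Quaternion.coe_mul_eq_smul]
  left_inv _ := rfl
  right_inv _ := rfl
  norm_map' _ := rfl

theorem toSlice_mul (z : ℂ) (q : ℍ[ℝ]) : toSlice I (embed I z * q) = z • toSlice I q := rfl

theorem toSlice_symm_smul (z : ℂ) (q : SliceMod I) :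
    (toSlice I).symm (z • q) = embed I z * (toSlice I).symm q := rfl

/-- `embed I` is a continuous real algebra map, so it commutes with `exp` and with real polynomials.
-/
theorem kernelA_embed (z : ℂ) (t : ℝ) : kernelA 1 (embed I z) t = embed I (kern z t) := by
  have hexp : ∀ w : ℂ, embed I (Complex.exp w) = NormedSpace.exp (embed I w) := fun w => by
    rw [Complex.exp_eq_exp_ℂ]
    exact NormedSpace.map_exp (embed I) (continuous_embed I) w
  have hk : ∀ w : ℂ, embed I (kappa * w) = kappa • embed I w := fun w => by
    rw [← Complex.real_smul, map_smul]
  rw [kern, hk, hexp, kernelA, ← kappa]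
  congr 2
  have h1 : -(z ^ 2 + (t : ℂ) ^ 2) / 2 + (√2 : ℝ) * (z * t)
      = (-1 / 2 : ℝ) • (z ^ 2 + (t : ℂ) ^ 2) + (1 * √2 : ℝ) • (z * t) := by
    simp only [Complex.real_smul]; push_cast; ring
  rw [h1, map_add, map_smul, map_smul, map_add, map_mul, map_pow, map_pow, embed_ofReal]

/-- The quaternionic Segal-Bargmann integral of a function. -/
def sb (ψ : ℝ → ℍ[ℝ]) (q : ℍ[ℝ]) : ℍ[ℝ] := ∫ t : ℝ, kernelA 1 q t * ψ t

theorem toSlice_sb_embed (ψ : ℝ → ℍ[ℝ]) (z : ℂ) :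
    toSlice I (sb ψ (embed I z)) = cB (toSlice I ∘ ψ) z := by
  rw [sb, cB]
  have := (toSlice I).toContinuousLinearEquiv.integral_comp_comm (μ := volume)
    (fun t => kernelA 1 (embed I z) t * ψ t)
  refine this.symm.trans (integral_congr_ae (.of_forall fun t => ?_))
  change toSlice I (kernelA 1 (embed I z) t * ψ t) = _
  rw [kernelA_embed, toSlice_mul]
  rfl

theorem memLp_toSlice {ψ : ℝ → ℍ[ℝ]} (hψ : MemLp ψ 2) : MemLp (toSlice I ∘ ψ) 2 :=
  (toSlice I).toContinuousLinearEquiv.toContinuousLinearMap.comp_memLp' hψ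

/-- `t` is real, hence central, so the exponents commute even though `ℍ` does not. -/
theorem kernelA_eq (q : ℍ[ℝ]) (t : ℝ) :
    kernelA 1 q t = (kappa • NormedSpace.exp ((-1 / 2 : ℝ) • q ^ 2)) *
      (Real.exp (-t ^ 2 / 2) • NormedSpace.exp (t • √2 • q)) := by
  have h0 : (-1 / 2 : ℝ) • (q ^ 2 + (t : ℍ[ℝ]) ^ 2) + (1 * √2) • (q * (t : ℍ[ℝ]))
      = (-1 / 2 : ℝ) • q ^ 2 + (t • √2 • q + ((-t ^ 2 / 2 : ℝ) : ℍ[ℝ])) := by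
    rw [Quaternion.mul_coe_eq_smul, smul_add, one_mul, smul_comm √2 t, add_assoc,
      add_comm (t • _)]
    congr 2
    rw [← Quaternion.coe_pow, ← Quaternion.coe_smul]
    congr 1
    simp; ring
  have hc1 : Commute (t • √2 • q) ((-t ^ 2 / 2 : ℝ) : ℍ[ℝ]) :=
    (Quaternion.coe_commutes _ _).symm
  have hc2 : Commute ((-1 / 2 : ℝ) • q ^ 2) (t • √2 • q + ((-t ^ 2 / 2 : ℝ) : ℍ[ℝ])) := by
    refine Commute.add_right ?_ (Quaternion.coe_commutes _ _).symm
    exact ((((Commute.refl q).pow_left 2).smul_left _).smul_right _).smul_right _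
  let _ : NormedAlgebra ℚ ℍ[ℝ] := NormedAlgebra.restrictScalars ℚ ℝ ℍ[ℝ]
  rw [kernelA, ← kappa, h0, NormedSpace.exp_add_of_commute hc2, NormedSpace.exp_add_of_commute hc1,
    Quaternion.exp_coe, Quaternion.mul_coe_eq_smul, smul_mul_assoc,
    Real.exp_eq_exp_ℝ]

/-- Holomorphy on each slice does not by itself give real differentiability on `ℍ`, so the Laplace
transform result is applied over `ℍ` itself. -/
theorem differentiable_sb {ψ : ℝ → ℍ[ℝ]} (hψ : MemLp ψ 2) : Differentiable ℝ (sb ψ) := by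
  have h := differentiable_integral_exp_smul (𝕜 := ℝ) (𝔸 := ℍ[ℝ])
    (ContinuousLinearMap.mul ℝ ℍ[ℝ])
    (aestronglyMeasurable_gaussian_smul hψ.1) (integrable_exp_mul_norm_gaussian hψ)
  have h2 := h.comp (g := _) (f := fun q : ℍ[ℝ] => √2 • q) (by fun_prop)
  have hexp : Differentiable ℝ (NormedSpace.exp : ℍ[ℝ] → ℍ[ℝ]) :=
    fun x => (NormedSpace.exp_analytic (𝕂 := ℝ) x).differentiableAt
  have h3 : Differentiable ℝ fun q : ℍ[ℝ] =>
      kappa • NormedSpace.exp ((-1 / 2 : ℝ) • q ^ 2) :=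
    (hexp.comp (by fun_prop)).const_smul kappa
  have h4 : sb ψ = fun q => (kappa • NormedSpace.exp ((-1 / 2 : ℝ) • q ^ 2)) *
      ∫ t : ℝ, NormedSpace.exp (t • √2 • q) * (Real.exp (-t ^ 2 / 2) • ψ t) := by
    ext1 q
    have hL := (ContinuousLinearMap.mul ℝ ℍ[ℝ]
      (kappa • NormedSpace.exp ((-1 / 2 : ℝ) • q ^ 2))).integral_comp_comm (μ := volume)
      (φ := fun t : ℝ => NormedSpace.exp (t • √2 • q) * (Real.exp (-t ^ 2 / 2) • ψ t)) ?_
    · refine Eq.trans ?_ hL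
      refine integral_congr_ae (.of_forall fun t => ?_)
      simp only [ContinuousLinearMap.mul_apply', kernelA_eq]
      rw [mul_assoc, smul_mul_assoc (Real.exp _), mul_smul_comm (Real.exp _) (NormedSpace.exp _)]
    · exact integrable_exp_smul_apply (𝕜 := ℝ) (ContinuousLinearMap.mul ℝ ℍ[ℝ])
        (aestronglyMeasurable_gaussian_smul hψ.1) (integrable_exp_mul_norm_gaussian hψ) (√2 • q)
  rw [h4]
  exact h3.mul h2

end SliceModule

/-! ### Slice regularity, the identity theorem and the bijection -/

section SliceRegular

theorem contDiff_slice_of_differentiable (I : imagUnits) {f : ℍ[ℝ] → ℍ[ℝ]} {g : ℂ → SliceMod I}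
    (hg : Differentiable ℂ g) (hfg : ∀ z, toSlice I (f (embed I z)) = g z) :
    ContDiff ℝ 1 fun p : ℝ × ℝ => f (slicePt I p.1 p.2) := by
  have h1 : ContDiff ℝ 1 g := (hg.contDiff (n := 1)).restrict_scalars ℝ
  have h2 : (fun p : ℝ × ℝ => f (slicePt I p.1 p.2))
      = (toSlice I).symm ∘ g ∘ Complex.equivRealProdCLM.symm := by
    ext1 p
    simp only [Function.comp_apply, ← hfg, LinearIsometryEquiv.symm_apply_apply]
    rw [embed_eq_slicePt]
    simp
  rw [h2]
  exact (toSlice I).symm.contDiff.comp (h1.comp Complex.equivRealProdCLM.symm.contDiff)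

theorem dbar_eq_zero_of_differentiable (I : imagUnits) {f : ℍ[ℝ] → ℍ[ℝ]} {g : ℂ → SliceMod I}
    (hg : Differentiable ℂ g) (hfg : ∀ z, toSlice I (f (embed I z)) = g z) (x y : ℝ) :
    (1 / 2 : ℝ) • (deriv (fun s : ℝ => f (slicePt I s y)) x
      + I.1 * deriv (fun t : ℝ => f (slicePt I x t)) y) = 0 := by
  have hf : ∀ a b : ℝ, f (slicePt I a b) = (toSlice I).symm (g (a + b * Complex.I)) := by
    intro a b
    rw [← hfg, LinearIsometryEquiv.symm_apply_apply, ← Complex.mk_eq_add_mul_I, embed_mk]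
  have hd := (hg (x + y * Complex.I)).hasDerivAt
  have h1 : HasDerivAt (fun s : ℝ => g (s + y * Complex.I)) (deriv g (x + y * Complex.I)) x := by
    have := hd.scomp x ((Complex.ofRealCLM.hasDerivAt (x := x)).add_const (y * Complex.I))
    simpa using! this
  have h2 : HasDerivAt (fun t : ℝ => g (x + t * Complex.I))
      (Complex.I • deriv g (x + y * Complex.I)) y := by
    have := hd.scomp y (((Complex.ofRealCLM.hasDerivAt (x := y)).mul_const
      Complex.I).const_add (x : ℂ))
    simpa using! this
  have h3 := ((toSlice I).symm.toContinuousLinearEquiv.toContinuousLinearMap.hasFDerivAt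
    ).comp_hasDerivAt x h1
  have h4 := ((toSlice I).symm.toContinuousLinearEquiv.toContinuousLinearMap.hasFDerivAt
    ).comp_hasDerivAt y h2
  simp only [hf]
  have e3 := h3.deriv
  have e4 := h4.deriv
  have e5 : (toSlice I).symm (Complex.I • deriv g (x + y * Complex.I))
      = I.1 * (toSlice I).symm (deriv g (x + y * Complex.I)) := by
    rw [toSlice_symm_smul, embed_I]
  erw [e3, e4]
  change (1 / 2 : ℝ) • ((toSlice I).symm (deriv g (x + y * Complex.I)) +
    I.1 * (toSlice I).symm (Complex.I • deriv g (x + y * Complex.I))) = 0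
  rw [e5, ← mul_assoc, mul_self_of_mem I.2]
  simp

/-- On every slice a slice regular function is holomorphic. -/
theorem IsSliceRegular.differentiable_slice {f : ℍ[ℝ] → ℍ[ℝ]} (hf : IsSliceRegular f)
    (I : imagUnits) : Differentiable ℂ fun z : ℂ => toSlice I (f (embed I z)) := by
  set h : ℝ × ℝ → ℍ[ℝ] := fun p => f (slicePt I p.1 p.2) with hh
  have hd : Differentiable ℝ h := (hf.contDiff_slice I I.2).differentiable (by norm_num)
  have hg : (fun z : ℂ => toSlice I (f (embed I z)))
      = toSlice I ∘ h ∘ Complex.equivRealProdCLM := by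
    ext1 z
    simp [hh, embed_eq_slicePt]
  intro z
  rw [hg, differentiableAt_complex_iff_differentiableAt_real]
  have hF : HasFDerivAt (toSlice I ∘ h ∘ Complex.equivRealProdCLM)
      (((toSlice I).toContinuousLinearEquiv.toContinuousLinearMap).comp
        ((fderiv ℝ h (Complex.equivRealProdCLM z)).comp
          Complex.equivRealProdCLM.toContinuousLinearMap)) z :=
    (toSlice I).toContinuousLinearEquiv.toContinuousLinearMap.hasFDerivAt.comp z
      ((hd _).hasFDerivAt.comp z Complex.equivRealProdCLM.toContinuousLinearMap.hasFDerivAt)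
  refine ⟨hF.differentiableAt, ?_⟩
  rw [hF.fderiv]
  have hfd := (hd (z.re, z.im)).hasFDerivAt
  have h1 : deriv (fun s : ℝ => f (slicePt I s z.im)) z.re = fderiv ℝ h (z.re, z.im) (1, 0) :=
    (HasFDerivAt.comp_hasDerivAt (l := h) (f := fun s : ℝ => (s, z.im)) z.re hfd
      ((hasDerivAt_id z.re).prodMk (hasDerivAt_const _ z.im))).deriv
  have h2 : deriv (fun t : ℝ => f (slicePt I z.re t)) z.im = fderiv ℝ h (z.re, z.im) (0, 1) :=
    (HasFDerivAt.comp_hasDerivAt (l := h) (f := fun t : ℝ => (z.re, t)) z.im hfd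
      ((hasDerivAt_const _ z.re).prodMk (hasDerivAt_id z.im))).deriv
  have h3 := hf.dbar_eq_zero I I.2 z.re z.im
  rw [h1, h2, smul_eq_zero_iff_right (by norm_num)] at h3
  change toSlice I (fderiv ℝ h (z.re, z.im) (0, 1))
    = Complex.I • toSlice I (fderiv ℝ h (z.re, z.im) (1, 0))
  rw [← toSlice_mul, embed_I]
  congr 1
  rw [eq_neg_of_add_eq_zero_left h3, mul_neg, ← mul_assoc, mul_self_of_mem I.2]
  simp

/-- The unit is the normalised imaginary part; `I₀` serves only real `q`, which lie on every slice.
-/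
theorem exists_embed_eq (q : ℍ[ℝ]) (I₀ : imagUnits) : ∃ (I : imagUnits) (z : ℂ), q = embed I z := by
  by_cases h : q.im = 0
  · refine ⟨I₀, q.re, ?_⟩
    rw [embed_ofReal]
    conv_lhs => rw [← q.re_add_im, h, add_zero]
  · have hn : ‖q.im‖ ≠ 0 := norm_ne_zero_iff.2 h
    have hI : ‖q.im‖⁻¹ • q.im ∈ imagUnits := by
      have h1 : q.im ^ 2 = -(Quaternion.normSq q.im : ℝ) :=
        Quaternion.sq_eq_neg_normSq.2 (by simp)
      change (‖q.im‖⁻¹ • q.im) ^ 2 = -1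
      rw [smul_pow, h1, Quaternion.normSq_eq_norm_mul_self, ← Quaternion.coe_neg,
        ← Quaternion.coe_smul, smul_eq_mul]
      have : ‖q.im‖⁻¹ ^ 2 * -(‖q.im‖ * ‖q.im‖) = -1 := by field_simp
      rw [this]; simp
    refine ⟨⟨_, hI⟩, ⟨q.re, ‖q.im‖⟩, ?_⟩
    rw [embed_mk, slicePt, Quaternion.coe_mul_eq_smul, smul_smul, mul_inv_cancel₀ hn, one_smul,
      q.re_add_im]

/-- Slice regular functions that agree on the real line are equal. -/
theorem IsSliceRegular.ext_real {f g : ℍ[ℝ] → ℍ[ℝ]} (hf : IsSliceRegular f)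
    (hg : IsSliceRegular g) (I₀ : imagUnits) (h : ∀ x : ℝ, f x = g x) : f = g := by
  ext1 q
  obtain ⟨I, z, rfl⟩ := exists_embed_eq q I₀
  have h1 : AnalyticOnNhd ℂ (fun z : ℂ => toSlice I (f (embed I z))) Set.univ :=
    (hf.differentiable_slice I).differentiableOn.analyticOnNhd isOpen_univ
  have h2 : AnalyticOnNhd ℂ (fun z : ℂ => toSlice I (g (embed I z))) Set.univ :=
    (hg.differentiable_slice I).differentiableOn.analyticOnNhd isOpen_univ
  -- The real line accumulates at `0`, which is all the identity theorem requires.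
  have hfr : ∃ᶠ w in nhdsWithin (0 : ℂ) {0}ᶜ,
      toSlice I (f (embed I w)) = toSlice I (g (embed I w)) := by
    have ht : Filter.Tendsto (fun x : ℝ => (x : ℂ)) (nhdsWithin 0 {0}ᶜ)
        (nhdsWithin (0 : ℂ) {0}ᶜ) := by
      refine tendsto_nhdsWithin_of_tendsto_nhds_of_eventually_within _ ?_ ?_
      · exact (Complex.continuous_ofReal.tendsto' 0 0 rfl).mono_left nhdsWithin_le_nhds
      · filter_upwards [self_mem_nhdsWithin] with x hx
        simpa using hx
    refine ht.frequently (Filter.Eventually.frequently (.of_forall fun x => ?_))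
    rw [embed_ofReal, h]
  have := congrFun (h1.eq_of_frequently_eq h2 hfr) z
  exact (toSlice I).injective this

theorem isSliceRegular_sb {ψ : ℝ → ℍ[ℝ]} (hψ : MemLp ψ 2) : IsSliceRegular (sb ψ) where
  differentiable := differentiable_sb hψ
  contDiff_slice I hI := contDiff_slice_of_differentiable ⟨I, hI⟩
    (differentiable_cB (memLp_toSlice ⟨I, hI⟩ hψ)) (toSlice_sb_embed ⟨I, hI⟩ ψ)
  dbar_eq_zero I hI := dbar_eq_zero_of_differentiable ⟨I, hI⟩
    (differentiable_cB (memLp_toSlice ⟨I, hI⟩ hψ)) (toSlice_sb_embed ⟨I, hI⟩ ψ)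

theorem integrable_slice_iff (J : imagUnits) {f : ℍ[ℝ] → ℍ[ℝ]} (hf : Continuous f) :
    Integrable (fun p : ℝ × ℝ =>
      ‖f (slicePt J p.1 p.2)‖ ^ 2 * Real.exp (-1 * ‖slicePt J p.1 p.2‖ ^ 2)) volume ↔
    MemLp (fun z : ℂ => Real.exp (-‖z‖ ^ 2 / 2) • toSlice J (f (embed J z))) 2 := by
  have hc : Continuous fun z : ℂ => Real.exp (-‖z‖ ^ 2 / 2) • toSlice J (f (embed J z)) :=
    Continuous.smul (f := fun z : ℂ => Real.exp (-‖z‖ ^ 2 / 2)) (by fun_prop)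
      ((toSlice J).continuous.comp (hf.comp (continuous_embed J)))
  rw [memLp_two_iff_integrable_sq_norm hc.aestronglyMeasurable,
    ← (Complex.volume_preserving_equiv_real_prod.symm).integrable_comp_emb
      Complex.measurableEquivRealProd.symm.measurableEmbedding]
  refine integrable_congr (.of_forall fun p => ?_)
  have hp : Complex.measurableEquivRealProd.symm p = ⟨p.1, p.2⟩ := rfl
  simp only [Function.comp_apply, hp]
  rw [norm_smul, LinearIsometryEquiv.norm_map, ← norm_embed J, embed_mk, mul_pow,
    Real.norm_of_nonneg (Real.exp_nonneg _), ← Real.exp_nat_mul, mul_comm]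
  congr 2
  push_cast
  ring

theorem mem_fockSpace_iff (J : imagUnits) (f : ℍ[ℝ] → ℍ[ℝ]) : f ∈ fockSpace 1 J ↔
    IsSliceRegular f ∧
    MemLp (fun z : ℂ => Real.exp (-‖z‖ ^ 2 / 2) • toSlice J (f (embed J z))) 2 :=
  and_congr_right fun hf => integrable_slice_iff J hf.differentiable.continuous

theorem segalBargmann_eq_sb (ψ : L2) : segalBargmann 1 ψ = sb ψ := rfl

theorem sb_congr {ψ φ : ℝ → ℍ[ℝ]} (h : ψ =ᵐ[volume] φ) : sb ψ = sb φ := by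
  ext1 q
  exact integral_congr_ae (by filter_upwards [h] with t ht; rw [ht])

theorem ae_eq_of_cB_eq {E : Type*} [NormedAddCommGroup E] [InnerProductSpace ℂ E]
    [CompleteSpace E] {ψ φ : ℝ → E} (hψ : MemLp ψ 2) (hφ : MemLp φ 2) (h : cB ψ = cB φ) :
    ψ =ᵐ[volume] φ := by
  have h0 : cB (ψ + (-1 : ℂ) • φ) = 0 := by
    rw [cB_add hψ (hφ.const_smul _), cB_smul, h]; simp
  filter_upwards [ae_eq_zero_of_cB_eq_zero (hψ.add (hφ.const_smul _)) h0] with t ht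
  simpa [← sub_eq_add_neg, sub_eq_zero] using ht

/-- Membership and injectivity are read off on the slice of `J` from the isometry. -/
theorem bijOn_segalBargmann (J : imagUnits) :
    Set.BijOn (segalBargmann 1) Set.univ (fockSpace 1 J) := by
  refine ⟨fun ψ _ => ?_, fun ψ _ φ _ h => ?_, fun f hf => ?_⟩
  · rw [mem_fockSpace_iff]
    refine ⟨isSliceRegular_sb (Lp.memLp ψ), ?_⟩
    have h := memLp_wB (memLp_toSlice J (Lp.memLp ψ))
    convert h using 1
    ext1 z
    rw [wB, ← toSlice_sb_embed]
    rfl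
  · have h1 : cB (toSlice J ∘ ψ) = cB (toSlice J ∘ φ) := by
      ext1 z
      rw [← toSlice_sb_embed, ← toSlice_sb_embed, ← segalBargmann_eq_sb, h, segalBargmann_eq_sb]
    refine Lp.ext ?_
    filter_upwards [ae_eq_of_cB_eq (memLp_toSlice J (Lp.memLp ψ)) (memLp_toSlice J (Lp.memLp φ))
      h1] with t ht
    exact (toSlice J).injective ht
  · rw [mem_fockSpace_iff] at hf
    obtain ⟨ψ, hψ⟩ := exists_cB_eq (hf.1.differentiable_slice J) hf.2
    have hm : MemLp ((toSlice J).symm ∘ ψ) 2 :=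
      (toSlice J).symm.toContinuousLinearEquiv.toContinuousLinearMap.comp_memLp' (Lp.memLp ψ)
    refine ⟨hm.toLp _, Set.mem_univ _, ?_⟩
    rw [segalBargmann_eq_sb, sb_congr hm.coeFn_toLp]
    -- The complex theorem gives agreement on the slice of `J` only; its real points propagate it to
    -- all of `ℍ`.
    refine (isSliceRegular_sb hm).ext_real hf.1 J fun x => (toSlice J).injective ?_
    rw [← embed_ofReal J, toSlice_sb_embed, ← Function.comp_assoc,
      show toSlice J ∘ (toSlice J).symm = id from funext (toSlice J).apply_symm_apply,
      Function.id_comp, hψ]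

end SliceRegular

/-! ### The quaternionic Fourier transform and the intertwining formula -/

section Fourier

variable (I : imagUnits)

theorem toSlice_fourierIntegral (ψ : ℝ → ℍ[ℝ]) (x : ℝ) :
    toSlice I (fourierIntegral I ψ x) = fourierC (toSlice I ∘ ψ) x := by
  rw [fourierIntegral, fourierC]
  have := (toSlice I).toContinuousLinearEquiv.integral_comp_comm (μ := volume)
    (fun y : ℝ => NormedSpace.exp (I.1 * (x : ℍ[ℝ]) * (y : ℍ[ℝ])) * ψ y)
  refine this.symm.trans (integral_congr_ae (.of_forall fun y => ?_))
  change toSlice I (NormedSpace.exp (I.1 * (x : ℍ[ℝ]) * (y : ℍ[ℝ])) * ψ y) = _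
  have hexp : NormedSpace.exp (I.1 * (x : ℍ[ℝ]) * (y : ℍ[ℝ]))
      = embed I (Complex.exp (Complex.I * x * y)) := by
    rw [Complex.exp_eq_exp_ℂ]
    refine Eq.trans ?_ (NormedSpace.map_exp (embed I) (continuous_embed I) _).symm
    rw [map_mul, map_mul, embed_I, embed_ofReal, embed_ofReal]
  rw [hexp, toSlice_mul]
  rfl

/-- The quaternionic Fourier transform on `L²(ℝ; ℍ)`, transported from the complex one. -/
def sliceFourierL2 : L2 →L[ℝ] L2 :=
  (((toSlice I).symm.toContinuousLinearEquiv.toContinuousLinearMap).compLpL 2 volume).comp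
    (((fourierCL2 (SliceMod I)).restrictScalars ℝ).comp
      (((toSlice I).toContinuousLinearEquiv.toContinuousLinearMap).compLpL 2 volume))

theorem toSlice_comp_sliceFourierL2 (ψ : L2) :
    toSlice I ∘ (sliceFourierL2 I ψ) =ᵐ[volume] (fourierCL2 (SliceMod I)
      (((toSlice I).toContinuousLinearEquiv.toContinuousLinearMap).compLpL 2 volume ψ)) := by
  filter_upwards [ContinuousLinearMap.coeFn_compLpL
    ((toSlice I).symm.toContinuousLinearEquiv.toContinuousLinearMap)
    (fourierCL2 (SliceMod I)
      (((toSlice I).toContinuousLinearEquiv.toContinuousLinearMap).compLpL 2 volume ψ))] with t ht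
  exact (congrArg (toSlice I) ht).trans ((toSlice I).apply_symm_apply _)

theorem coeFn_compLpL_toSlice (ψ : L2) :
    (((toSlice I).toContinuousLinearEquiv.toContinuousLinearMap).compLpL 2 volume ψ :
      ℝ → SliceMod I) =ᵐ[volume] toSlice I ∘ ψ :=
  ContinuousLinearMap.coeFn_compLpL _ _

theorem fourierC_congr {E : Type*} [NormedAddCommGroup E] [InnerProductSpace ℂ E]
    {ψ φ : ℝ → E} (h : ψ =ᵐ[volume] φ) : fourierC ψ = fourierC φ := by
  ext1 x
  exact integral_congr_ae (by filter_upwards [h] with t ht; rw [ht])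

theorem isFourierExtension_sliceFourierL2 : IsFourierExtension I (sliceFourierL2 I) := by
  intro ψ hψ
  have h1 := coeFn_compLpL_toSlice I ψ
  have hint : Integrable (toSlice I ∘ ψ) :=
    (toSlice I).toContinuousLinearEquiv.toContinuousLinearMap.integrable_comp hψ
  filter_upwards [toSlice_comp_sliceFourierL2 I ψ, coeFn_fourierCL2 _ (hint.congr h1.symm)]
    with t h2 h3
  refine (toSlice I).injective ?_
  rw [toSlice_fourierIntegral, ← fourierC_congr h1, ← h3, ← h2]
  rfl

theorem IsFourierExtension.unique {I : ℍ[ℝ]} {S T : L2 →L[ℝ] L2} (hS : IsFourierExtension I S)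
    (hT : IsFourierExtension I T) : S = T := by
  refine ContinuousLinearMap.coeFn_injective (S.continuous.ext_on dense_integrable T.continuous
    fun ψ hψ => Lp.ext ((hS ψ hψ).trans (hT ψ hψ).symm))

theorem fourierL2_eq : fourierL2 I = sliceFourierL2 I := by
  have h : ∃ T : L2 →L[ℝ] L2, IsFourierExtension I T := ⟨_, isFourierExtension_sliceFourierL2 I⟩
  rw [fourierL2, dif_pos h]
  -- `fourierL2` is an arbitrary choice of extension; uniqueness by density identifies it with the
  -- transported operator.
  exact h.choose_spec.unique (isFourierExtension_sliceFourierL2 I)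

theorem segalBargmann_fourierL2 (ψ : L2) (x : ℝ) :
    segalBargmann 1 (fourierL2 I ψ) (x : ℍ[ℝ])
      = √(2 * Real.pi) • segalBargmann 1 ψ (I * (x : ℍ[ℝ])) := by
  have hx : I.1 * (x : ℍ[ℝ]) = embed I (Complex.I * x) := by
    rw [map_mul, embed_I, embed_ofReal]
  refine (toSlice I).injective ?_
  rw [hx, map_smul, segalBargmann_eq_sb, segalBargmann_eq_sb, ← embed_ofReal I,
    toSlice_sb_embed, toSlice_sb_embed, fourierL2_eq, cB_congr (toSlice_comp_sliceFourierL2 I ψ),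
    cB_fourierCL2, cB_congr (coeFn_compLpL_toSlice I ψ)]

end Fourier

end SliceFock

end

theorem mainTheorem4 (I J : ℍ[ℝ]) (hI : I ∈ SliceFock.imagUnits) (hJ : J ∈ SliceFock.imagUnits) :
    Set.BijOn (SliceFock.segalBargmann 1) Set.univ (SliceFock.fockSpace 1 J) ∧
    (∃! T : SliceFock.L2 →L[ℝ] SliceFock.L2, SliceFock.IsFourierExtension I T) ∧
    ∀ f ∈ SliceFock.fockSpace 1 J, ∀ x : ℝ,
      SliceFock.segalBargmann 1 (SliceFock.fourierL2 I (SliceFock.segalBargmannInv 1 f)) (x : ℍ[ℝ])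
        = Real.sqrt (2 * Real.pi) • f (I * (x : ℍ[ℝ])) := by
  have hbij := SliceFock.bijOn_segalBargmann ⟨J, hJ⟩
  refine ⟨hbij, ⟨SliceFock.sliceFourierL2 ⟨I, hI⟩,
    SliceFock.isFourierExtension_sliceFourierL2 ⟨I, hI⟩,
    fun T hT => hT.unique (SliceFock.isFourierExtension_sliceFourierL2 ⟨I, hI⟩)⟩,
    fun f hf x => ?_⟩
  obtain ⟨ψ, -, hψ⟩ := hbij.surjOn hf
  -- `Function.invFun` is a genuine right inverse only on the range, hence the appeal to
  -- surjectivity.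
  have hinv : SliceFock.segalBargmann 1 (SliceFock.segalBargmannInv 1 f) = f :=
    Function.invFun_eq ⟨ψ, hψ⟩
  rw [SliceFock.segalBargmann_fourierL2 ⟨I, hI⟩, hinv]
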